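/- **Notation.** $\mathbb{H}$ is the skew field of real quaternions, $A^{*}$ is the conjugate transpose, and $\|\cdot\|$ is the Frobenius norm. The rank of $A\in\mathbb{H}^{m\times n}$ is the maximal number of left linearly independent rows (equivalently, of right linearly independent columns). The Moore–Penrose inverse $A^{+}$ is the unique $P\in\mathbb{H}^{n\times m}$ with $(AP)^{*}=AP$, $(PA)^{*}=PA$, $APA=A$, $PAP=P$. For a square quaternion matrix $M=(m_{ij})$ with rows and columns indexed by a finite set $\alpha$ of integers with $|\alpha|=k$, and for $i\in\alpha$, the $i$-th row determinant is $$\operatorname{rdet}_i M=\sum_{\sigma}(-1)^{k-c(\sigma)}\,\prod_{C}\; m_{x,\sigma(x)}\,m_{\sigma(x),\sigma^{2}(x)}\cdots m_{\sigma^{l-1}(x),x},$$ where $\sigma$ runs over the permutations of $\alpha$, $c(\sigma)$ is the number of cycles of $\sigma$ (fixed points included), and the ordered product from left to right runs over the cycles $C$ of $\sigma$ ($l$ is the length of $C$ and $x$ its opening element). The first cycle is the one containing $i$, opened by $x=i$; each other cycle is opened by its least element, and these cycles stand in increasing order of their least elements. If $M$ is Hermitian, all $\operatorname{rdet}_i M$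 are equal; the common value is denoted $\det M$ or $|M|$, and the determinant of the empty matrix is $1$. $M^{\alpha}_{\alpha}$ is the principal submatrix on the rows and columns in $\alpha$, which keep their original indices. $M_{j.}(b)$ is $M$ with its $j$-th row replaced by the row $b$. $I_{r,m}$ is the set of $r$-element subsets of $\{1,\dots,m\}$, and $I_{r,m}\{j\}$ is the set of those that contain $j$. Write $\operatorname{ddet}A=\det(AA^{*})$. **Theorem 4.4.** Let $A\in\mathbb{H}^{m\times n}$, $B\in\mathbb{H}^{s\times n}$, and let $\check b_{i.}$ be the $i$-th row of $\check B=BA^{*}\in\mathbb{H}^{s\times m}$. The Moore–Penrose inverse $A^{+}$ exists and is unique. The equation $XA=B$ has exactly one minimum norm least squares solution $X_{LS}=(x_{ij})\in\mathbb{H}^{s\times m}$, that is, exactly one matrix of least norm among the minimizers $X$ of $\|XA-B\|$, and $X_{LS}=BA^{+}$. Moreover: (i) If $\operatorname{rank}A=r\le n<m$, then $\sum_{\alpha\in I_{r,m}}\left|(AA^{*})^{\alpha}_{\alpha}\right|\neq 0$ and, for all $1\le i\le s$, $1\le j\le m$, $$x_{ij}=\frac{\displaystyle\sum_{\alpha\in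 I_{r,m}\{j\}}\operatorname{rdet}_j\Big(\big((AA^{*})_{j.}(\check b_{i.})\big)^{\alpha}_{\alpha}\Big)}{\displaystyle\sum_{\alpha\in I_{r,m}}\left|(AA^{*})^{\alpha}_{\alpha}\right|}.$$ (ii) If $\operatorname{rank}A=m$, then $\operatorname{ddet}A\neq 0$ and, for all $1\le i\le s$, $1\le j\le m$, $$x_{ij}=\frac{\operatorname{rdet}_j\big((AA^{*})_{j.}(\check b_{i.})\big)}{\operatorname{ddet}A}.$$ -/

import Mathlib

open scoped Matrix Quaternion

namespace QuatCramer

section RowDeterminant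

variable {R ι : Type*} [Ring R] [Fintype ι] [LinearOrder ι]

/-- The ordered product `a_{x, σ x} a_{σ x, σ² x} ⋯ a_{σ^{l-1} x, x}` along the cycle of `σ` that
contains `x`, opened at `x`; here `l` is the length of that cycle (`l = 1` for a fixed point). -/
noncomputable def cycleProd (A : Matrix ι ι R) (σ : Equiv.Perm ι) (x : ι) : R :=
  ((List.range (Function.minimalPeriod σ x)).map
    fun t => A ((σ ^ t) x) ((σ ^ (t + 1)) x)).prod

open Classical in
/-- The least elements of the cycles of `σ` (fixed points included) that do not contain `i`,
listed in increasing order. -/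
noncomputable def cycleLeaders (σ : Equiv.Perm ι) (i : ι) : List ι :=
  (Finset.univ.filter fun x => ¬ σ.SameCycle i x ∧ ∀ y, σ.SameCycle x y → x ≤ y).sort (· ≤ ·)

/-- The `i`-th row determinant. Each permutation `σ` is written in left-ordered cycle notation:
the first cycle is opened by `i`, every other cycle by its least element, and those other cycles
stand in increasing order of their least elements. The monomial of `σ` multiplies the entries in
this order, and its sign `(-1)^(n - number of cycles)` is the sign of `σ`. -/
noncomputable def rdet (i : ι) (A : Matrix ι ι R) : R :=
  ∑ σ : Equiv.Perm ι, Equiv.Perm.sign σ •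
    (cycleProd A σ i * ((cycleLeaders σ i).map (cycleProd A σ)).prod)

/-- The determinant of a Hermitian quaternion matrix. All row determinants of a Hermitian matrix
coincide; the one at the least index is taken. The determinant of the empty matrix is `1`. -/
noncomputable def hdet (A : Matrix ι ι R) : R :=
  if h : (Finset.univ : Finset ι).Nonempty then rdet (Finset.univ.min' h) A else 1

/-- The principal submatrix with rows and columns in `α`; its rows and columns keep their
original indices. -/
def principal (A : Matrix ι ι R) (α : Finset ι) : Matrix {x // x ∈ α} {x // x ∈ α} R :=
  A.submatrix Subtype.val Subtype.val

/-- The sum over the `r`-element sets `α` of indices with `j ∈ α` of the row determinants, along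
the row of (original) index `j`, of the principal submatrices on `α`. -/
noncomputable def sumPrincipalRdet (r : ℕ) (j : ι) (A : Matrix ι ι R) : R :=
  ∑ α : {α : Finset ι // α.card = r ∧ j ∈ α}, rdet ⟨j, α.2.2⟩ (principal A α.1)

/-- The sum of all principal minors of order `r` of a Hermitian matrix. -/
noncomputable def sumPrincipalMinors (r : ℕ) (A : Matrix ι ι R) : R :=
  ∑ α ∈ Finset.univ.powersetCard r, hdet (principal A α)

end RowDeterminant

section Quaternion

variable {m n s : ℕ}

/-- The double determinant `det (A A*)`. For a matrix with `m` rows it is the determinant of an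
`m × m` Hermitian matrix; for a square matrix it also equals `det (A* A)`. -/
noncomputable def ddet (A : Matrix (Fin m) (Fin n) ℍ[ℝ]) : ℍ[ℝ] :=
  hdet (A * Aᴴ)

/-- The rank of a quaternion matrix: the maximal number of left linearly independent rows, which
is also the maximal number of right linearly independent columns. (The left span of the columns
may have a different dimension.) -/
noncomputable def rank (A : Matrix (Fin m) (Fin n) ℍ[ℝ]) : ℕ :=
  Module.finrank ℍ[ℝ] (Submodule.span ℍ[ℝ] (Set.range A.row))

/-- The four Penrose conditions: `P` is the Moore-Penrose inverse of `A`. -/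
structure IsMoorePenrose (A : Matrix (Fin m) (Fin n) ℍ[ℝ]) (P : Matrix (Fin n) (Fin m) ℍ[ℝ]) :
    Prop where
  left_hermitian : (A * P)ᴴ = A * P
  right_hermitian : (P * A)ᴴ = P * A
  mul_mul_self : A * P * A = A
  self_mul_mul : P * A * P = P

attribute [local instance] Matrix.frobeniusNormedAddCommGroup

/-- `X` is a least squares solution of `X A = B`, with respect to the Frobenius norm. -/
def IsLeastSquares (A : Matrix (Fin m) (Fin n) ℍ[ℝ]) (B : Matrix (Fin s) (Fin n) ℍ[ℝ])
    (X : Matrix (Fin s) (Fin m) ℍ[ℝ]) : Prop :=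
  ∀ Y : Matrix (Fin s) (Fin m) ℍ[ℝ], ‖X * A - B‖ ≤ ‖Y * A - B‖

/-- `X` is a minimum norm least squares solution of `X A = B`, with respect to the Frobenius
norm. -/
def IsMinNormLeastSquares (A : Matrix (Fin m) (Fin n) ℍ[ℝ]) (B : Matrix (Fin s) (Fin n) ℍ[ℝ])
    (X : Matrix (Fin s) (Fin m) ℍ[ℝ]) : Prop :=
  IsLeastSquares A B X ∧
    ∀ Y : Matrix (Fin s) (Fin m) ℍ[ℝ], IsLeastSquares A B Y → ‖X‖ ≤ ‖Y‖

end Quaternion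

end QuatCramer

set_option linter.unusedSectionVars false

namespace QuatCramer

section RowExpansion

variable {R ι κ : Type*} [Ring R] [Fintype ι] [LinearOrder ι] [Fintype κ] [LinearOrder κ]

/-- The permutation of `ι` that sends `k` to `l` and becomes `τ` once `k` is removed from its
cycle. -/
def insertPerm {k : ι} (f : κ ≃o {x : ι // x ≠ k}) (l : ι) (τ : Equiv.Perm κ) : Equiv.Perm ι :=
  Equiv.swap k l * τ.extendDomain f.toEquiv

variable {k : ι} (f : κ ≃o {x : ι // x ≠ k})

theorem insertPerm_self (l : ι) (τ : Equiv.Perm κ) : insertPerm f l τ k = l := by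
  simp [insertPerm, Equiv.Perm.extendDomain_apply_not_subtype]

theorem extendDomain_apply_coe (τ : Equiv.Perm κ) (a : κ) :
    τ.extendDomain f.toEquiv (f a : ι) = f (τ a) :=
  Equiv.Perm.extendDomain_apply_image τ f.toEquiv a

theorem insertPerm_coe_of_ne {l : ι} {τ : Equiv.Perm κ} {a : κ} (h : (f (τ a) : ι) ≠ l) :
    insertPerm f l τ (f a) = f (τ a) := by
  rw [insertPerm, Equiv.Perm.mul_apply, extendDomain_apply_coe,
    Equiv.swap_apply_of_ne_of_ne (f (τ a)).2 h]

theorem insertPerm_coe_of_eq {l : ι} {τ : Equiv.Perm κ} {a : κ} (h : (f (τ a) : ι) = l) :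
    insertPerm f l τ (f a) = k := by
  rw [insertPerm, Equiv.Perm.mul_apply, extendDomain_apply_coe, h, Equiv.swap_apply_right]

theorem exists_coe_eq {x : ι} (hx : x ≠ k) : ∃ a, (f a : ι) = x :=
  ⟨f.symm ⟨x, hx⟩, by simp⟩

theorem coe_injective : Function.Injective fun a => (f a : ι) :=
  Subtype.val_injective.comp f.injective

theorem insertPerm_bijective :
    Function.Bijective fun p : ι × Equiv.Perm κ => insertPerm f p.1 p.2 := by
  rw [Fintype.bijective_iff_injective_and_card]
  constructor
  · rintro ⟨l, τ⟩ ⟨l', τ'⟩ h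
    have hl : l = l' := by
      simpa [insertPerm_self] using congrArg (fun σ : Equiv.Perm ι => σ k) h
    subst hl
    have h' : τ.extendDomain f.toEquiv = τ'.extendDomain f.toEquiv := by
      simpa [insertPerm] using h
    rw [Equiv.Perm.extendDomainHom_injective f.toEquiv h']
  · have hc : Fintype.card ι = Fintype.card κ + 1 := by
      rw [Fintype.card_congr f.toEquiv, Fintype.card_subtype_compl, Fintype.card_subtype_eq]
      have : 0 < Fintype.card ι := Fintype.card_pos_iff.2 ⟨k⟩
      omega
    rw [Fintype.card_prod, Fintype.card_perm, Fintype.card_perm, hc, Nat.factorial_succ]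

theorem sign_insertPerm_self (τ : Equiv.Perm κ) :
    Equiv.Perm.sign (insertPerm f k τ) = Equiv.Perm.sign τ := by
  simp [insertPerm, Equiv.Perm.sign_extendDomain]

theorem sign_insertPerm_coe (b : κ) (τ : Equiv.Perm κ) :
    Equiv.Perm.sign (insertPerm f (f b) τ) = -Equiv.Perm.sign τ := by
  simp [insertPerm, Equiv.Perm.sign_extendDomain, Equiv.Perm.sign_swap (f b).2.symm]

section OffCycle

variable {f} {l : ι} {τ : Equiv.Perm κ} {a : κ}

theorem insertPerm_pow_coe (h : ∀ t : ℕ, (f ((τ ^ t) a) : ι) ≠ l) (t : ℕ) :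
    (insertPerm f l τ ^ t) (f a) = f ((τ ^ t) a) := by
  induction t with
  | zero => simp
  | succ t ih =>
    have := h (t + 1)
    rw [pow_succ', Equiv.Perm.mul_apply] at this
    rw [pow_succ', Equiv.Perm.mul_apply, ih, insertPerm_coe_of_ne f this, pow_succ',
      Equiv.Perm.mul_apply]

theorem minimalPeriod_insertPerm_coe (h : ∀ t : ℕ, (f ((τ ^ t) a) : ι) ≠ l) :
    Function.minimalPeriod (insertPerm f l τ) (f a : ι) = Function.minimalPeriod τ a := by
  rw [Function.minimalPeriod_eq_minimalPeriod_iff]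
  intro t
  rw [Function.IsPeriodicPt, Function.IsPeriodicPt, Function.IsFixedPt, Function.IsFixedPt,
    Equiv.Perm.iterate_eq_pow, Equiv.Perm.iterate_eq_pow, insertPerm_pow_coe h]
  exact (coe_injective f).eq_iff

theorem cycleProd_insertPerm_coe (h : ∀ t : ℕ, (f ((τ ^ t) a) : ι) ≠ l) {M : Matrix ι ι R}
    {N : Matrix κ κ R} (hN : ∀ c d, (f d : ι) ≠ l → N c d = M (f c) (f d)) :
    cycleProd M (insertPerm f l τ) (f a) = cycleProd N τ a := by
  unfold cycleProd
  rw [minimalPeriod_insertPerm_coe h]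
  congr 1
  refine List.map_congr_left fun t _ => ?_
  rw [insertPerm_pow_coe h, insertPerm_pow_coe h, hN _ _ (h _)]

theorem sameCycle_iff_exists_pow {α : Type*} [Finite α] {σ : Equiv.Perm α} {x y : α} :
    σ.SameCycle x y ↔ ∃ t : ℕ, (σ ^ t) x = y :=
  ⟨fun h => let ⟨i, _, hi⟩ := h.exists_pow_eq'; ⟨i, hi⟩, fun ⟨t, ht⟩ => ⟨t, by simpa using ht⟩⟩

theorem sameCycle_insertPerm_coe_left (h : ∀ t : ℕ, (f ((τ ^ t) a) : ι) ≠ l) {y : ι} :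
    (insertPerm f l τ).SameCycle (f a) y ↔ ∃ c, τ.SameCycle a c ∧ (f c : ι) = y := by
  simp only [sameCycle_iff_exists_pow, insertPerm_pow_coe h]
  constructor
  · rintro ⟨t, rfl⟩
    exact ⟨_, ⟨t, rfl⟩, rfl⟩
  · rintro ⟨c, ⟨t, rfl⟩, rfl⟩
    exact ⟨t, rfl⟩

end OffCycle

theorem coe_pow_ne_of_not_sameCycle {τ : Equiv.Perm κ} {a b : κ} (h : ¬ τ.SameCycle b a) (t : ℕ) :
    (f ((τ ^ t) a) : ι) ≠ f b := by
  intro he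
  exact h (sameCycle_iff_exists_pow.2 ⟨t, coe_injective f he⟩).symm

theorem coe_pow_ne_self (τ : Equiv.Perm κ) (a : κ) (t : ℕ) : (f ((τ ^ t) a) : ι) ≠ k :=
  (f _).2

section OnCycle

variable (b : κ) (τ : Equiv.Perm κ)

theorem minimalPeriod_perm_pos {α : Type*} [Finite α] (σ : Equiv.Perm α) (x : α) :
    0 < Function.minimalPeriod σ x := by
  cases nonempty_fintype α
  classical
  exact Function.minimalPeriod_pos_of_mem_periodicPts
    ⟨orderOf σ, orderOf_pos σ, by
      rw [Function.IsPeriodicPt, Function.IsFixedPt, Equiv.Perm.iterate_eq_pow, pow_orderOf_eq_one]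
      rfl⟩

theorem insertPerm_pow_self {t : ℕ} (ht : t < Function.minimalPeriod τ b) :
    (insertPerm f (f b) τ ^ (t + 1)) k = f ((τ ^ t) b) := by
  induction t with
  | zero => simp [insertPerm_self]
  | succ t ih =>
    rw [pow_succ', Equiv.Perm.mul_apply, ih (by omega), insertPerm_coe_of_ne, pow_succ',
      Equiv.Perm.mul_apply]
    intro he
    have he' : (τ ^ (t + 1)) b = b := by
      rw [pow_succ', Equiv.Perm.mul_apply]
      exact coe_injective f he
    have := Function.IsPeriodicPt.minimalPeriod_le (f := τ) (x := b) (n := t + 1) (by omega)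
      (by rw [Function.IsPeriodicPt, Function.IsFixedPt, Equiv.Perm.iterate_eq_pow, he'])
    omega

theorem pow_minimalPeriod_apply {α : Type*} (σ : Equiv.Perm α) (x : α) :
    (σ ^ Function.minimalPeriod σ x) x = x := by
  rw [← Equiv.Perm.iterate_eq_pow]
  exact Function.iterate_minimalPeriod

theorem insertPerm_pow_minimalPeriod :
    (insertPerm f (f b) τ ^ (Function.minimalPeriod τ b + 1)) k = k := by
  have hp := minimalPeriod_perm_pos τ b
  have hq := pow_minimalPeriod_apply τ b
  obtain ⟨q, hq'⟩ : ∃ q, Function.minimalPeriod τ b = q + 1 := ⟨_, (Nat.sub_add_cancel hp).symm⟩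
  rw [hq'] at hq ⊢
  rw [pow_succ', Equiv.Perm.mul_apply, insertPerm_pow_self f b τ (by omega), insertPerm_coe_of_eq]
  rw [← Equiv.Perm.mul_apply, ← pow_succ', hq]

theorem minimalPeriod_insertPerm_self :
    Function.minimalPeriod (insertPerm f (f b) τ) k = Function.minimalPeriod τ b + 1 := by
  apply le_antisymm
  · apply Function.IsPeriodicPt.minimalPeriod_le (by omega)
    rw [Function.IsPeriodicPt, Function.IsFixedPt, Equiv.Perm.iterate_eq_pow,
      insertPerm_pow_minimalPeriod]
  · by_contra! hlt
    have hpos := minimalPeriod_perm_pos (insertPerm f (f b) τ) k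
    have hk := pow_minimalPeriod_apply (insertPerm f (f b) τ) k
    obtain ⟨q, hq⟩ : ∃ q, Function.minimalPeriod (insertPerm f (f b) τ) k = q + 1 :=
      ⟨_, (Nat.sub_add_cancel hpos).symm⟩
    rw [hq, insertPerm_pow_self f b τ (by omega)] at hk
    exact (f _).2 hk

theorem cycleProd_insertPerm_self (M : Matrix ι ι R) :
    cycleProd M (insertPerm f (f b) τ) k = M k (f b) *
      cycleProd ((M.submatrix (fun a => (f a : ι)) fun a => (f a : ι)).updateCol b
        fun a => M (f a) k) τ b := by
  have hp := minimalPeriod_perm_pos τ b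
  have hend := insertPerm_pow_minimalPeriod f b τ
  have hend' := pow_minimalPeriod_apply τ b
  have hmin : ∀ t, t + 1 < Function.minimalPeriod τ b → (τ ^ (t + 1)) b ≠ b := by
    intro t ht he
    have := Function.IsPeriodicPt.minimalPeriod_le (f := τ) (x := b) (n := t + 1) (by omega)
      (by rw [Function.IsPeriodicPt, Function.IsFixedPt, Equiv.Perm.iterate_eq_pow, he])
    omega
  unfold cycleProd
  rw [minimalPeriod_insertPerm_self]
  have hpow := fun t => insertPerm_pow_self f b τ (t := t)
  obtain ⟨q, hq⟩ : ∃ q, Function.minimalPeriod τ b = q + 1 := ⟨_, (Nat.sub_add_cancel hp).symm⟩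
  rw [hq] at hend hend' hmin hpow ⊢
  rw [List.range_succ_eq_map, List.map_cons, List.prod_cons, List.map_map]
  congr 1
  · simp [insertPerm_self]
  · congr 1
    refine List.map_congr_left fun t ht => ?_
    rw [List.mem_range] at ht
    simp only [Function.comp, Nat.succ_eq_add_one]
    rw [hpow t (by omega)]
    by_cases htq : t = q
    · subst htq
      rw [hend, hend', Matrix.updateCol_self]
    · rw [hpow (t + 1) (by omega), Matrix.updateCol_ne (hmin t (by omega)), Matrix.submatrix_apply]

theorem sameCycle_insertPerm_self {a : κ} :
    (insertPerm f (f b) τ).SameCycle k (f a) ↔ τ.SameCycle b a := by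
  constructor
  · intro h
    obtain ⟨t, ht⟩ := sameCycle_iff_exists_pow.1 h
    have key : ∀ t : ℕ, (insertPerm f (f b) τ ^ t) k = k ∨
        ∃ c, τ.SameCycle b c ∧ (insertPerm f (f b) τ ^ t) k = f c := by
      intro t
      induction t with
      | zero => simp
      | succ t ih =>
        rw [pow_succ', Equiv.Perm.mul_apply]
        rcases ih with h | ⟨c, hc, h⟩
        · rw [h, insertPerm_self]
          exact Or.inr ⟨b, Equiv.Perm.SameCycle.refl _ _, rfl⟩
        · rw [h]
          by_cases he : (f (τ c) : ι) = f b
          · exact Or.inl (insertPerm_coe_of_eq f he)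
          · exact Or.inr ⟨τ c, Equiv.Perm.sameCycle_apply_right.2 hc, insertPerm_coe_of_ne f he⟩
    rcases key t with h' | ⟨c, hc, h'⟩
    · exact absurd (ht.symm.trans h') (f a).2
    · rwa [coe_injective f (ht.symm.trans h')]
  · intro h
    obtain ⟨t, rfl⟩ := sameCycle_iff_exists_pow.1 h
    refine sameCycle_iff_exists_pow.2 ⟨t % Function.minimalPeriod τ b + 1, ?_⟩
    rw [insertPerm_pow_self f b τ (Nat.mod_lt _ (minimalPeriod_perm_pos τ b)),
      ← Equiv.Perm.iterate_eq_pow, Function.iterate_mod_minimalPeriod_eq,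
      Equiv.Perm.iterate_eq_pow]

end OnCycle

theorem sort_map_coe (s : Finset κ) :
    (s.map ⟨fun a => (f a : ι), coe_injective f⟩).sort (· ≤ ·) =
      (s.sort (· ≤ ·)).map fun a => (f a : ι) := by
  refine (Finset.map_sort ⟨fun a => (f a : ι), coe_injective f⟩ s (· ≤ ·) (· ≤ ·) ?_).symm
  intro a _ b _
  exact (f.le_iff_le (x := a) (y := b)).symm

theorem cycleLeaders_insertPerm_coe (b : κ) (τ : Equiv.Perm κ) :
    cycleLeaders (insertPerm f (f b) τ) k = (cycleLeaders τ b).map fun a => (f a : ι) := by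
  classical
  unfold cycleLeaders
  rw [← sort_map_coe]
  congr 1
  ext x
  simp only [Finset.mem_filter, Finset.mem_univ, true_and, Finset.mem_map,
    Function.Embedding.coeFn_mk]
  constructor
  · rintro ⟨h1, h2⟩
    obtain ⟨a, rfl⟩ := exists_coe_eq f (x := x) (by rintro rfl; exact h1 (.refl _ _))
    rw [sameCycle_insertPerm_self] at h1
    refine ⟨a, ⟨h1, fun c hc => ?_⟩, rfl⟩
    exact f.le_iff_le.1 (h2 _ ((sameCycle_insertPerm_coe_left
      (coe_pow_ne_of_not_sameCycle f h1)).2 ⟨c, hc, rfl⟩))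
  · rintro ⟨a, ⟨h1, h2⟩, rfl⟩
    rw [sameCycle_insertPerm_self]
    refine ⟨h1, fun y hy => ?_⟩
    obtain ⟨c, hc, rfl⟩ := (sameCycle_insertPerm_coe_left
      (coe_pow_ne_of_not_sameCycle f h1)).1 hy
    exact f.le_iff_le.2 (h2 c hc)

open Classical in
theorem cycleLeaders_insertPerm_self (τ : Equiv.Perm κ) :
    cycleLeaders (insertPerm f k τ) k =
      ((Finset.univ.filter fun x => ∀ y, τ.SameCycle x y → x ≤ y).sort (· ≤ ·)).map
        fun a => (f a : ι) := by
  unfold cycleLeaders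
  rw [← sort_map_coe]
  congr 1
  ext x
  simp only [Finset.mem_filter, Finset.mem_univ, true_and, Finset.mem_map,
    Function.Embedding.coeFn_mk]
  constructor
  · rintro ⟨h1, h2⟩
    obtain ⟨a, rfl⟩ := exists_coe_eq f (x := x) (by rintro rfl; exact h1 (.refl _ _))
    refine ⟨a, fun c hc => ?_, rfl⟩
    exact f.le_iff_le.1 (h2 _ ((sameCycle_insertPerm_coe_left (coe_pow_ne_self f τ a)).2
      ⟨c, hc, rfl⟩))
  · rintro ⟨a, h2, rfl⟩
    constructor
    · intro h
      obtain ⟨c, -, hc⟩ := (sameCycle_insertPerm_coe_left (coe_pow_ne_self f τ a)).1 h.symm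
      exact (f c).2 hc
    · intro y hy
      obtain ⟨c, hc, rfl⟩ := (sameCycle_insertPerm_coe_left (coe_pow_ne_self f τ a)).1 hy
      exact f.le_iff_le.2 (h2 c hc)

open Classical in
theorem sort_leaders_eq_cons (h : (Finset.univ : Finset κ).Nonempty) (τ : Equiv.Perm κ) :
    (Finset.univ.filter fun x => ∀ y, τ.SameCycle x y → x ≤ y).sort (· ≤ ·) =
      Finset.univ.min' h :: cycleLeaders τ (Finset.univ.min' h) := by
  unfold cycleLeaders
  rw [← Finset.sort_insert]
  · congr 1
    ext x
    simp only [Finset.mem_filter, Finset.mem_univ, true_and, Finset.mem_insert]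
    constructor
    · intro hx
      by_cases hc : τ.SameCycle (Finset.univ.min' h) x
      · exact Or.inl (le_antisymm (hx _ hc.symm) (Finset.min'_le _ _ (Finset.mem_univ _)))
      · exact Or.inr ⟨hc, hx⟩
    · rintro (rfl | ⟨-, hx⟩)
      · exact fun y _ => Finset.min'_le _ _ (Finset.mem_univ _)
      · exact hx
  · exact fun b _ => Finset.min'_le _ _ (Finset.mem_univ _)
  · exact fun hm => (Finset.mem_filter.1 hm).2.1 (.refl _ _)

open Classical in
theorem hdet_eq_sum (A : Matrix κ κ R) :
    hdet A = ∑ τ : Equiv.Perm κ, Equiv.Perm.sign τ •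
      (((Finset.univ.filter fun x => ∀ y, τ.SameCycle x y → x ≤ y).sort
        (· ≤ ·)).map (cycleProd A τ)).prod := by
  unfold hdet
  split_ifs with h
  · unfold rdet
    refine Finset.sum_congr rfl fun τ _ => ?_
    rw [sort_leaders_eq_cons h, List.map_cons, List.prod_cons]
  · have : IsEmpty κ := by
      rw [Finset.univ_nonempty_iff, not_nonempty_iff] at h
      exact h
    have h0 : ∀ s : Finset κ, s = ∅ := fun s => Finset.eq_empty_of_isEmpty s
    simp [h0]

theorem cycleProd_insertPerm_fixed (M : Matrix ι ι R) (τ : Equiv.Perm κ) :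
    cycleProd M (insertPerm f k τ) k = M k k := by
  have h : Function.minimalPeriod (insertPerm f k τ) k = 1 :=
    Function.minimalPeriod_eq_one_iff_isFixedPt.2 (insertPerm_self f k τ)
  simp [cycleProd, h, insertPerm_self]

/-- Expansion of the `k`-th row determinant along the `k`-th row. -/
theorem rdet_eq_sub_sum (M : Matrix ι ι R) :
    rdet k M = M k k * hdet (M.submatrix (fun a => (f a : ι)) fun a => (f a : ι)) -
      ∑ b, M k (f b) * rdet b ((M.submatrix (fun a => (f a : ι)) fun a => (f a : ι)).updateCol b
        fun a => M (f a) k) := by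
  have hsplit : ∀ g : ι → R, ∑ l, g l = g k + ∑ b, g (f b) := by
    intro g
    rw [Fintype.sum_eq_add_sum_subtype_ne g k]
    congr 1
    exact (Equiv.sum_comp f.toEquiv fun x : {x : ι // x ≠ k} => g x).symm
  have h1 : rdet k M = ∑ l, ∑ τ : Equiv.Perm κ, Equiv.Perm.sign (insertPerm f l τ) •
      (cycleProd M (insertPerm f l τ) k *
        ((cycleLeaders (insertPerm f l τ) k).map (cycleProd M (insertPerm f l τ))).prod) := by
    rw [rdet, ← (insertPerm_bijective f).sum_comp, Fintype.sum_prod_type]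
  rw [h1, hsplit, sub_eq_add_neg]
  congr 1
  · rw [hdet_eq_sum, Finset.mul_sum]
    refine Finset.sum_congr rfl fun τ _ => ?_
    rw [sign_insertPerm_self, cycleProd_insertPerm_fixed, cycleLeaders_insertPerm_self,
      List.map_map, mul_smul_comm]
    congr 4
    funext a
    exact cycleProd_insertPerm_coe (coe_pow_ne_self f τ a) fun _ _ _ => rfl
  · rw [← Finset.sum_neg_distrib]
    refine Finset.sum_congr rfl fun b _ => ?_
    rw [rdet, Finset.mul_sum, ← Finset.sum_neg_distrib]
    refine Finset.sum_congr rfl fun τ _ => ?_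
    rw [sign_insertPerm_coe, cycleProd_insertPerm_self, cycleLeaders_insertPerm_coe, List.map_map,
      mul_smul_comm, ← mul_assoc, Units.neg_smul]
    congr 4
    refine List.map_congr_left fun a ha => ?_
    have ha' : ¬ τ.SameCycle b a := by
      unfold cycleLeaders at ha
      rw [Finset.mem_sort] at ha
      exact (Finset.mem_filter.1 ha).2.1
    refine cycleProd_insertPerm_coe (coe_pow_ne_of_not_sameCycle f ha') fun c d hd => ?_
    rw [Matrix.updateCol_ne fun h => hd (by rw [h]), Matrix.submatrix_apply]

end RowExpansion

section PrincipalExpansion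

variable {R ι : Type*} [Ring R] [Fintype ι] [LinearOrder ι]

/-- The principal minor on `α`, as a function of the ambient matrix. -/
noncomputable def pminor (M : Matrix ι ι R) (α : Finset ι) : R := hdet (principal M α)

open Classical in
/-- The `k`-th row determinant of the principal submatrix on `α` whose `k`-th column is replaced
by `c`; it is `0` if `k ∉ α`. -/
noncomputable def colRdet (M : Matrix ι ι R) (α : Finset ι) (k : ι) (c : ι → R) : R :=
  if hk : k ∈ α then
    rdet ⟨k, hk⟩ ((principal M α).updateCol ⟨k, hk⟩ fun x => c x)
  else 0

/-- The expansion of a row determinant of order `|s| + 1` whose first row is `b`, whose first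
column is `c` below the diagonal, and whose remaining block is the principal submatrix on `s`. -/
noncomputable def borderRdet (M : Matrix ι ι R) (s : Finset ι) (k : ι) (b c : ι → R) : R :=
  b k * pminor M s - ∑ l ∈ s, b l * colRdet M s l c

theorem colRdet_of_notMem {M : Matrix ι ι R} {α : Finset ι} {k : ι} (hk : k ∉ α) (c : ι → R) :
    colRdet M α k c = 0 := dif_neg hk

theorem colRdet_congr {M M' : Matrix ι ι R} {α : Finset ι} {k : ι} {c c' : ι → R}
    (hM : ∀ x ∈ α, ∀ y ∈ α, M x y = M' x y) (hc : ∀ x ∈ α, c x = c' x) :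
    colRdet M α k c = colRdet M' α k c' := by
  unfold colRdet
  split_ifs with hk
  · congr 1
    ext x y
    simp only [Matrix.updateCol_apply, principal, Matrix.submatrix_apply]
    rw [hc _ x.2, hM _ x.2 _ y.2]
  · rfl

theorem pminor_empty (M : Matrix ι ι R) : pminor M ∅ = 1 := by
  unfold pminor hdet
  rw [dif_neg]
  rintro ⟨⟨x, hx⟩, -⟩
  simp at hx

/-- A finite set without `k` is the complement of `k` after inserting `k`. -/
def insertIso {s : Finset ι} {k : ι} (hk : k ∉ s) :
    {x // x ∈ s} ≃o {x : {x // x ∈ insert k s} // x ≠ ⟨k, Finset.mem_insert_self k s⟩} where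
  toFun x := ⟨⟨x, Finset.mem_insert_of_mem x.2⟩, fun h => hk
    ((congrArg (fun y : {x // x ∈ insert k s} => (y : ι) ∈ s) h).mp x.2)⟩
  invFun x := ⟨x.1.1, (Finset.mem_insert.1 x.1.2).resolve_left fun h => x.2 (Subtype.ext h)⟩
  left_inv _ := rfl
  right_inv _ := rfl
  map_rel_iff' := Iff.rfl

/-- The complement of `k` as a subtype. -/
def complIso {s : Finset ι} {k : ι} (hs : ∀ x, x ∈ s ↔ x ≠ k) :
    {x // x ∈ s} ≃o {x : ι // x ≠ k} where
  toFun x := ⟨x, (hs x).1 x.2⟩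
  invFun x := ⟨x, (hs x).2 x.2⟩
  left_inv _ := rfl
  right_inv _ := rfl
  map_rel_iff' := Iff.rfl

theorem rdet_insert {s : Finset ι} {k : ι} (hk : k ∉ s) (M : Matrix ι ι R) {b c : ι → R}
    (N : Matrix {x // x ∈ insert k s} {x // x ∈ insert k s} R)
    (hN : ∀ x y : {x // x ∈ insert k s}, x.1 ∈ s → y.1 ∈ s → N x y = M x y)
    (hb : ∀ y, N ⟨k, Finset.mem_insert_self k s⟩ y = b y)
    (hc : ∀ x : {x // x ∈ insert k s}, x.1 ∈ s → N x ⟨k, Finset.mem_insert_self k s⟩ = c x) :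
    rdet ⟨k, Finset.mem_insert_self k s⟩ N = borderRdet M s k b c := by
  have hsub : N.submatrix (fun a => ((insertIso hk) a).1) (fun a => ((insertIso hk) a).1) =
      principal M s := by
    ext x y
    exact hN _ _ x.2 y.2
  rw [rdet_eq_sub_sum (insertIso hk), hsub, borderRdet, hb, pminor]
  congr 1
  rw [← Finset.sum_coe_sort s fun l => b l * colRdet M s l c]
  refine Finset.sum_congr rfl fun l _ => ?_
  have hcol : (fun a => N ((insertIso hk) a).1 ⟨k, Finset.mem_insert_self k s⟩) =
      fun x : {x // x ∈ s} => c x := funext fun x => hc _ x.2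
  rw [hb, colRdet, dif_pos l.2, hcol]
  rfl

theorem colRdet_insert {s : Finset ι} {k : ι} (hk : k ∉ s) (M : Matrix ι ι R) (c : ι → R) :
    colRdet M (insert k s) k c = c k * pminor M s - ∑ l ∈ s, M k l * colRdet M s l c := by
  rw [colRdet, dif_pos (Finset.mem_insert_self k s),
    rdet_insert hk M (b := Function.update (M k) k (c k)) (c := c), borderRdet,
    Function.update_self]
  · congr 1
    refine Finset.sum_congr rfl fun l hl => ?_
    rw [Function.update_of_ne (by rintro rfl; exact hk hl)]
  · intro x y hx hy
    rw [Matrix.updateCol_ne, principal, Matrix.submatrix_apply]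
    rintro rfl
    exact hk hy
  · intro y
    by_cases hy : y = ⟨k, Finset.mem_insert_self k s⟩
    · subst hy
      simp
    · rw [Matrix.updateCol_ne hy, Function.update_of_ne fun h => hy (Subtype.ext h), principal,
        Matrix.submatrix_apply]
  · intro x _
    rw [Matrix.updateCol_self]

theorem rdet_principal_updateRow {s : Finset ι} {k : ι} (hk : k ∉ s) (M : Matrix ι ι R)
    (b : ι → R) (h : k ∈ insert k s) :
    rdet ⟨k, h⟩ (principal (M.updateRow k b) (insert k s)) =
      borderRdet M s k b fun p => M p k := by
  refine rdet_insert hk M _ ?_ ?_ ?_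
  · intro x y hx _
    rw [principal, Matrix.submatrix_apply, Matrix.updateRow_ne (by intro h; exact hk (h ▸ hx))]
  · intro y
    rw [principal, Matrix.submatrix_apply, Matrix.updateRow_self]
  · intro x hx
    rw [principal, Matrix.submatrix_apply,
      Matrix.updateRow_ne (by intro h; exact hk (h ▸ hx))]

theorem rdet_updateRow (k : ι) (M : Matrix ι ι R) (b : ι → R) :
    rdet k (M.updateRow k b) = borderRdet M (Finset.univ.erase k) k b fun p => M p k := by
  have hs : ∀ x, x ∈ Finset.univ.erase k ↔ x ≠ k := by simp
  have hsub : (M.updateRow k b).submatrix (fun a => ((complIso hs) a).1)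
      (fun a => ((complIso hs) a).1) = principal M (Finset.univ.erase k) := by
    ext x y
    exact congrFun (Matrix.updateRow_ne ((hs _).1 x.2)) _
  rw [rdet_eq_sub_sum (complIso hs), hsub, borderRdet, Matrix.updateRow_self, pminor]
  congr 1
  rw [← Finset.sum_coe_sort (Finset.univ.erase k) fun l => b l * colRdet M _ l fun p => M p k]
  refine Finset.sum_congr rfl fun l _ => ?_
  have hcol : (fun a => M.updateRow k b ((complIso hs) a).1 k) =
      fun x : {x // x ∈ Finset.univ.erase k} => M x k :=
    funext fun x => congrFun (Matrix.updateRow_ne ((hs _).1 x.2)) _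
  rw [colRdet, dif_pos l.2, hcol]
  rfl

theorem pminor_insert_of_lt {s : Finset ι} {k : ι} (hk : ∀ x ∈ s, k < x) (M : Matrix ι ι R) :
    pminor M (insert k s) = borderRdet M s k (M k) fun p => M p k := by
  have hks : k ∉ s := fun h => lt_irrefl _ (hk k h)
  have hne : (Finset.univ : Finset {x // x ∈ insert k s}).Nonempty :=
    ⟨⟨k, Finset.mem_insert_self k s⟩, Finset.mem_univ _⟩
  have hmin : Finset.univ.min' hne = ⟨k, Finset.mem_insert_self k s⟩ := by
    refine le_antisymm (Finset.min'_le _ _ (Finset.mem_univ _)) (Finset.le_min' _ _ _ ?_)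
    rintro ⟨y, hy⟩ -
    rcases Finset.mem_insert.1 hy with rfl | hy
    · exact le_rfl
    · exact (hk y hy).le
  rw [pminor, hdet, dif_pos hne, hmin, rdet_insert hks M]
  · exact fun _ _ _ _ => rfl
  · exact fun _ => rfl
  · exact fun _ _ => rfl

theorem pminor_insert_of_lt_eq_colRdet {s : Finset ι} {k : ι} (hk : ∀ x ∈ s, k < x)
    (M : Matrix ι ι R) :
    pminor M (insert k s) = colRdet M (insert k s) k fun p => M p k := by
  rw [pminor_insert_of_lt hk, colRdet_insert fun h => lt_irrefl _ (hk k h), borderRdet]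

theorem hdet_eq_pminor (M : Matrix ι ι R) : hdet M = pminor M Finset.univ := by
  by_cases hne : (Finset.univ : Finset ι).Nonempty
  · have hins := Finset.insert_erase (Finset.min'_mem _ hne)
    conv_rhs => rw [← hins]
    rw [pminor_insert_of_lt, ← rdet_updateRow, Matrix.updateRow_eq_self, hdet, dif_pos hne]
    intro x hx
    exact lt_of_le_of_ne (Finset.min'_le _ _ (Finset.mem_univ _)) (Finset.ne_of_mem_erase hx).symm
  · rw [Finset.not_nonempty_iff_eq_empty.1 hne, pminor_empty, hdet, dif_neg hne]

theorem colRdet_mul (M : Matrix ι ι R) (s : Finset ι) (k : ι) (c : ι → R) (q : R)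
    (hq : ∀ α ⊆ s, Commute q (pminor M α)) :
    colRdet M s k (fun p => c p * q) = colRdet M s k c * q := by
  induction s using Finset.strongInduction generalizing k with
  | H s ih =>
    by_cases hk : k ∈ s
    · rw [← Finset.insert_erase hk, colRdet_insert (Finset.notMem_erase k s),
        colRdet_insert (Finset.notMem_erase k s), sub_mul, Finset.sum_mul]
      congr 1
      · rw [mul_assoc, mul_assoc, (hq _ (Finset.erase_subset _ _)).eq]
      · refine Finset.sum_congr rfl fun l _ => ?_
        rw [ih _ (Finset.erase_ssubset hk) l fun α hα => hq α (hα.trans (Finset.erase_subset _ _)),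
          mul_assoc]
    · simp only [colRdet_of_notMem hk, zero_mul]

section ScalarShift

variable {S : Type*} [CommRing S] [Algebra S R]

theorem borderRdet_shift {M : Matrix ι ι R} {s : Finset ι} {k : ι} (t : S)
    (b c : ι → R)
    (hD : pminor (M + t • 1) s = ∑ β ∈ s.powerset, t ^ (s \ β).card • pminor M β)
    (hf : ∀ l c, colRdet (M + t • 1) s l c =
      ∑ β ∈ s.powerset, t ^ (s \ β).card • colRdet M β l c) :
    borderRdet (M + t • 1) s k b c =
      ∑ β ∈ s.powerset, t ^ (s \ β).card • borderRdet M β k b c := by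
  simp only [borderRdet, hD, hf, Finset.mul_sum, smul_sub, Finset.sum_sub_distrib,
    mul_smul_comm]
  congr 1
  rw [Finset.sum_comm]
  refine Finset.sum_congr rfl fun β hβ => ?_
  rw [Finset.smul_sum]
  refine (Finset.sum_subset (Finset.mem_powerset.1 hβ) fun l _ hl => ?_).symm
  rw [colRdet_of_notMem hl, mul_zero, smul_zero]

theorem colRdet_insert_eq_borderRdet {s : Finset ι} {k : ι} (hk : k ∉ s) (M : Matrix ι ι R)
    (c : ι → R) :
    colRdet M (insert k s) k c = borderRdet M s k (Function.update (M k) k (c k)) c := by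
  rw [colRdet_insert hk, borderRdet, Function.update_self]
  congr 1
  refine Finset.sum_congr rfl fun l hl => ?_
  rw [Function.update_of_ne (by rintro rfl; exact hk hl)]

theorem borderRdet_congr {M : Matrix ι ι R} {s : Finset ι} {k : ι} {b b' c c' : ι → R}
    (hb : b k = b' k) (hb' : ∀ l ∈ s, b l = b' l) (hc : ∀ l ∈ s, c l = c' l) :
    borderRdet M s k b c = borderRdet M s k b' c' := by
  rw [borderRdet, borderRdet, hb]
  congr 1
  refine Finset.sum_congr rfl fun l hl => ?_
  rw [hb' l hl, colRdet_congr (fun _ _ _ _ => rfl) hc]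

theorem shift_apply_ne (M : Matrix ι ι R) (t : S) {i j : ι} (h : i ≠ j) :
    (M + t • (1 : Matrix ι ι R)) i j = M i j := by
  simp [Matrix.one_apply_ne h]

theorem sum_powerset_insert_shift {s : Finset ι} {k : ι} (hk : k ∉ s) (t : S)
    (g : Finset ι → R) :
    ∑ β ∈ (insert k s).powerset, t ^ (insert k s \ β).card • g β =
      t • ∑ β ∈ s.powerset, t ^ (s \ β).card • g β +
        ∑ β ∈ s.powerset, t ^ (s \ β).card • g (insert k β) := by
  rw [Finset.sum_powerset_insert hk, Finset.smul_sum]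
  congr 1
  · refine Finset.sum_congr rfl fun β hβ => ?_
    have hkβ : k ∉ β := fun h => hk (Finset.mem_powerset.1 hβ h)
    rw [Finset.insert_sdiff_of_notMem _ hkβ,
      Finset.card_insert_of_notMem fun h => hk (Finset.mem_sdiff.1 h).1, pow_succ', mul_smul]
  · refine Finset.sum_congr rfl fun β hβ => ?_
    rw [Finset.insert_sdiff_insert, Finset.sdiff_insert_of_notMem hk]

theorem shift_expansion (M : Matrix ι ι R) (t : S) (s : Finset ι) :
    pminor (M + t • 1) s = ∑ β ∈ s.powerset, t ^ (s \ β).card • pminor M β ∧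
    ∀ k c, colRdet (M + t • 1) s k c =
      ∑ β ∈ s.powerset, t ^ (s \ β).card • colRdet M β k c := by
  induction s using Finset.strongInduction with
  | H s ih =>
    constructor
    · rcases s.eq_empty_or_nonempty with rfl | hne
      · simp [pminor_empty]
      · have hmem := Finset.min'_mem s hne
        obtain ⟨hD, hf⟩ := ih _ (Finset.erase_ssubset hmem)
        have hlt : ∀ x ∈ s.erase (s.min' hne), s.min' hne < x := fun x hx =>
          lt_of_le_of_ne (Finset.min'_le _ _ (Finset.mem_of_mem_erase hx))
            (Finset.ne_of_mem_erase hx).symm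
        have hins := Finset.insert_erase hmem
        generalize s.erase (s.min' hne) = u at *
        generalize s.min' hne = k at *
        subst hins
        have hk : k ∉ u := fun h => lt_irrefl _ (hlt k h)
        rw [sum_powerset_insert_shift hk, ← hD, pminor_insert_of_lt hlt]
        have h1 : borderRdet (M + t • 1) u k ((M + t • 1) k) (fun p => (M + t • 1) p k) =
            t • pminor (M + t • 1) u + borderRdet (M + t • 1) u k (M k) (fun p => M p k) := by
          rw [borderRdet_congr (b' := Function.update (M k) k (M k k + t • 1))
            (c' := fun p => M p k)]
          · rw [borderRdet, borderRdet, Function.update_self, add_mul, smul_one_mul]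
            rw [add_comm (M k k * _), add_sub_assoc]
            congr 2
            refine Finset.sum_congr rfl fun l hl => ?_
            rw [Function.update_of_ne (by rintro rfl; exact hk hl)]
          · simp
          · intro l hl
            have hkl : k ≠ l := by rintro rfl; exact hk hl
            rw [shift_apply_ne _ _ hkl, Function.update_of_ne hkl.symm]
          · intro l hl
            exact shift_apply_ne _ _ (by rintro rfl; exact hk hl)
        rw [h1, borderRdet_shift t _ _ hD hf]
        congr 1
        refine Finset.sum_congr rfl fun β hβ => ?_
        rw [pminor_insert_of_lt fun x hx => hlt x (Finset.mem_powerset.1 hβ hx)]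
    · intro k c
      by_cases hk : k ∈ s
      · obtain ⟨hD, hf⟩ := ih _ (Finset.erase_ssubset hk)
        have hku := Finset.notMem_erase k s
        rw [← Finset.insert_erase hk]
        generalize s.erase k = u at *
        rw [sum_powerset_insert_shift hku, colRdet_insert_eq_borderRdet hku,
          borderRdet_congr (b' := Function.update (M k) k (c k)) (c' := c),
          borderRdet_shift t _ _ hD hf,
          Finset.sum_eq_zero (s := u.powerset)
            (f := fun β => t ^ (u \ β).card • colRdet M β k c), smul_zero, zero_add]
        · refine Finset.sum_congr rfl fun β hβ => ?_
          rw [colRdet_insert_eq_borderRdet fun h => hku (Finset.mem_powerset.1 hβ h)]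
        · intro β hβ
          rw [colRdet_of_notMem fun h => hku (Finset.mem_powerset.1 hβ h), smul_zero]
        · simp
        · intro l hl
          have hkl : k ≠ l := by rintro rfl; exact hku hl
          rw [Function.update_of_ne hkl.symm, Function.update_of_ne hkl.symm,
            shift_apply_ne _ _ hkl]
        · exact fun _ _ => rfl
      · rw [colRdet_of_notMem hk, Finset.sum_eq_zero]
        intro β hβ
        rw [colRdet_of_notMem fun h => hk (Finset.mem_powerset.1 hβ h), smul_zero]

theorem pminor_shift (M : Matrix ι ι R) (t : S) (s : Finset ι) :
    pminor (M + t • 1) s = ∑ β ∈ s.powerset, t ^ (s \ β).card • pminor M β :=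
  (shift_expansion M t s).1

theorem colRdet_shift (M : Matrix ι ι R) (t : S) (s : Finset ι) (k : ι) (c : ι → R) :
    colRdet (M + t • 1) s k c = ∑ β ∈ s.powerset, t ^ (s \ β).card • colRdet M β k c :=
  (shift_expansion M t s).2 k c

theorem pminor_univ_shift (M : Matrix ι ι R) (t : S) :
    pminor (M + t • 1) Finset.univ =
      ∑ r ∈ Finset.range (Fintype.card ι + 1),
        t ^ (Fintype.card ι - r) • sumPrincipalMinors r M := by
  rw [pminor_shift, Finset.sum_powerset]
  refine Finset.sum_congr rfl fun r _ => ?_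
  rw [sumPrincipalMinors, Finset.smul_sum]
  refine Finset.sum_congr rfl fun β hβ => ?_
  rw [Finset.card_sdiff_of_subset (Finset.subset_univ β), (Finset.mem_powersetCard.1 hβ).2]
  rfl

theorem sumPrincipalRdet_updateRow (M : Matrix ι ι R) (r : ℕ) (j : ι) (b : ι → R) :
    sumPrincipalRdet r j (M.updateRow j b) =
      ∑ β ∈ (Finset.univ.erase j).powerset with β.card + 1 = r,
        borderRdet M β j b fun p => M p j := by
  unfold sumPrincipalRdet
  symm
  refine Finset.sum_bij (fun β hβ => ⟨insert j β, ?_, Finset.mem_insert_self _ _⟩) ?_ ?_ ?_ ?_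
  · obtain ⟨h1, h2⟩ := Finset.mem_filter.1 hβ
    have hj : j ∉ β := fun h => Finset.notMem_erase j _ (Finset.mem_powerset.1 h1 h)
    rw [Finset.card_insert_of_notMem hj, h2]
  · exact fun _ _ => Finset.mem_univ _
  · intro β hβ γ hγ h
    have hj : j ∉ β := fun h =>
      Finset.notMem_erase j _ (Finset.mem_powerset.1 (Finset.mem_filter.1 hβ).1 h)
    have hj' : j ∉ γ := fun h =>
      Finset.notMem_erase j _ (Finset.mem_powerset.1 (Finset.mem_filter.1 hγ).1 h)
    have h' : insert j β = insert j γ := congrArg Subtype.val h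
    rw [← Finset.erase_insert hj, ← Finset.erase_insert hj', h']
  · rintro ⟨α, hα, hj⟩ -
    refine ⟨α.erase j, ?_, Subtype.ext (Finset.insert_erase hj)⟩
    rw [Finset.mem_filter, Finset.mem_powerset]
    exact ⟨Finset.erase_subset_erase _ (Finset.subset_univ _),
      by rw [Finset.card_erase_add_one hj, hα]⟩
  · intro β hβ
    have hj : j ∉ β := fun h =>
      Finset.notMem_erase j _ (Finset.mem_powerset.1 (Finset.mem_filter.1 hβ).1 h)
    exact (rdet_principal_updateRow hj M b _).symm

theorem rdet_updateRow_shift (M : Matrix ι ι R) (t : S) (j : ι) (b : ι → R) :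
    rdet j ((M + t • 1).updateRow j b) =
      ∑ r ∈ Finset.range (Fintype.card ι + 1),
        t ^ (Fintype.card ι - r) • sumPrincipalRdet r j (M.updateRow j b) := by
  rw [rdet_updateRow, borderRdet_congr (b' := b) (c' := fun p => M p j) rfl (fun _ _ => rfl),
    borderRdet_shift t _ _ (pminor_shift M t _)
      (fun l c => colRdet_shift M t _ l c)]
  · simp only [sumPrincipalRdet_updateRow, Finset.smul_sum]
    rw [← Finset.sum_fiberwise_of_maps_to (t := Finset.range (Fintype.card ι + 1))
      (g := fun β : Finset ι => β.card + 1)]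
    · refine Finset.sum_congr rfl fun r _ => Finset.sum_congr rfl fun β hβ => ?_
      obtain ⟨h1, h2⟩ := Finset.mem_filter.1 hβ
      rw [Finset.card_sdiff_of_subset (Finset.mem_powerset.1 h1),
        Finset.card_erase_of_mem (Finset.mem_univ j), ← h2, Finset.card_univ]
      congr 2
      omega
    · intro β hβ
      have h1 := Finset.card_le_card (Finset.mem_powerset.1 hβ)
      rw [Finset.card_erase_of_mem (Finset.mem_univ j), Finset.card_univ] at h1
      have : 0 < Fintype.card ι := Fintype.card_pos_iff.2 ⟨j⟩
      rw [Finset.mem_range]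
      omega
  · intro l hl
    exact shift_apply_ne _ _ (Finset.ne_of_mem_erase hl)

end ScalarShift

end PrincipalExpansion

section PosDef

variable {ι : Type*} [Fintype ι] [LinearOrder ι]

/-- Positive definiteness of a quaternion matrix on the vectors supported in `α`. -/
def PosDefOn (H : Matrix ι ι ℍ[ℝ]) (α : Finset ι) : Prop :=
  ∀ x : ι → ℍ[ℝ], (∀ p ∉ α, x p = 0) → x ≠ 0 → 0 < (star x ⬝ᵥ (H *ᵥ x)).re

theorem PosDefOn.mono {H : Matrix ι ι ℍ[ℝ]} {α β : Finset ι} (h : PosDefOn H β) (hαβ : α ⊆ β) :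
    PosDefOn H α :=
  fun x hx => h x fun p hp => hx p fun hp' => hp (hαβ hp')

theorem star_form {H : Matrix ι ι ℍ[ℝ]} (hH : Hᴴ = H) (x y : ι → ℍ[ℝ]) :
    star (star x ⬝ᵥ (H *ᵥ y)) = star y ⬝ᵥ (H *ᵥ x) := by
  rw [← Matrix.star_dotProduct, Matrix.star_mulVec, hH, Matrix.dotProduct_mulVec]

theorem form_eq_re {H : Matrix ι ι ℍ[ℝ]} (hH : Hᴴ = H) (x : ι → ℍ[ℝ]) :
    star x ⬝ᵥ (H *ᵥ x) = ((star x ⬝ᵥ (H *ᵥ x)).re : ℍ[ℝ]) :=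
  Quaternion.star_eq_self.1 (star_form hH x x)

/-- Cut off a vector outside `α`. -/
noncomputable def restrictLin (α : Finset ι) : (ι → ℍ[ℝ]) →ₗ[ℝ] (ι → ℍ[ℝ]) where
  toFun x p := if p ∈ α then x p else 0
  map_add' x y := by ext1 p; by_cases h : p ∈ α <;> simp [h]
  map_smul' t x := by ext1 p; by_cases h : p ∈ α <;> simp [h]

/-- Multiplication of a column by a quaternion matrix, as a real linear map. -/
noncomputable def mulVecReal (H : Matrix ι ι ℍ[ℝ]) : (ι → ℍ[ℝ]) →ₗ[ℝ] (ι → ℍ[ℝ]) where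
  toFun x := H *ᵥ x
  map_add' := Matrix.mulVec_add H
  map_smul' t x := Matrix.mulVec_smul H t x

theorem PosDefOn.exists_mulVec_eq {H : Matrix ι ι ℍ[ℝ]} {α : Finset ι} (h : PosDefOn H α)
    (c : ι → ℍ[ℝ]) : ∃ x : ι → ℍ[ℝ], (∀ p ∉ α, x p = 0) ∧ ∀ p ∈ α, (H *ᵥ x) p = c p := by
  let T : (ι → ℍ[ℝ]) →ₗ[ℝ] (ι → ℍ[ℝ]) :=
    restrictLin α ∘ₗ mulVecReal H ∘ₗ restrictLin α + restrictLin αᶜ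
  have hin : ∀ x, ∀ p ∈ α, T x p = (H *ᵥ restrictLin α x) p := fun x p hp => by
    simp [T, restrictLin, mulVecReal, hp]
  have hout : ∀ x, ∀ p ∉ α, T x p = x p := fun x p hp => by
    simp [T, restrictLin, hp]
  have hinj : Function.Injective T := by
    rw [injective_iff_map_eq_zero]
    intro x hx
    have h0 : ∀ p ∉ α, x p = 0 := fun p hp => by rw [← hout x p hp, hx]; rfl
    have hrx : restrictLin α x = x := by
      ext1 p
      by_cases hp : p ∈ α
      · simp [restrictLin, hp]
      · simp [restrictLin, hp, h0 p hp]
    by_contra hne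
    have hpos := h x h0 hne
    have hz : star x ⬝ᵥ (H *ᵥ x) = 0 := by
      refine Finset.sum_eq_zero fun p _ => ?_
      by_cases hp : p ∈ α
      · have := hin x p hp
        rw [hrx, hx] at this
        rw [← this]
        simp
      · simp [h0 p hp]
    rw [hz] at hpos
    simp at hpos
  obtain ⟨x, hx⟩ := LinearMap.injective_iff_surjective.1 hinj (restrictLin α c)
  refine ⟨restrictLin α x, fun p hp => by simp [restrictLin, hp], fun p hp => ?_⟩
  rw [← hin x p hp, hx]
  simp [restrictLin, hp]

/-- Cramer's rule for the principal submatrix on `α`, with positive determinant. -/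
def CramerOn (H : Matrix ι ι ℍ[ℝ]) (α : Finset ι) (d : ℝ) : Prop :=
  0 < d ∧ pminor H α = d ∧
    ∀ x : ι → ℍ[ℝ], (∀ p ∉ α, x p = 0) → ∀ k ∈ α, colRdet H α k (H *ᵥ x) = d * x k

/-- `z` solves `H z = σ e_k` on `insert k s` and is normalized by `z k = 1`. -/
structure IsPivot (H : Matrix ι ι ℍ[ℝ]) (s : Finset ι) (k : ι) (z : ι → ℍ[ℝ]) (σ : ℝ) : Prop where
  supp : ∀ p ∉ insert k s, z p = 0
  one : z k = 1
  zero : ∀ p ∈ s, (H *ᵥ z) p = 0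
  pivot : (H *ᵥ z) k = σ

theorem dotProduct_eq_of_supp {s : Finset ι} {x y : ι → ℍ[ℝ]} {k : ι} (hk : k ∉ s)
    (hx : ∀ p ∉ insert k s, x p = 0) :
    y ⬝ᵥ x = y k * x k + ∑ p ∈ s, y p * x p := by
  rw [← Finset.sum_insert hk (f := fun p => y p * x p), dotProduct]
  refine (Finset.sum_subset (Finset.subset_univ _) fun p _ hp => ?_).symm
  rw [hx p hp, mul_zero]

theorem IsPivot.pos {H : Matrix ι ι ℍ[ℝ]} {s : Finset ι} {k : ι}
    {z : ι → ℍ[ℝ]} {σ : ℝ} (hz : IsPivot H s k z σ) (hH : PosDefOn H (insert k s)) : 0 < σ := by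
  have h := hH z hz.supp fun h => by simpa [h] using hz.one
  have h1 : star z ⬝ᵥ (H *ᵥ z) = σ := by
    rw [dotProduct, Finset.sum_eq_single k]
    · simp [hz.one, hz.pivot]
    · intro p _ hpk
      by_cases hp : p ∈ s
      · rw [hz.zero p hp, mul_zero]
      · simp [hz.supp p (by simp [hp, hpk])]
    · simp
  rw [h1] at h
  simpa using h

theorem exists_pivot {H : Matrix ι ι ℍ[ℝ]} (hH : Hᴴ = H) {s : Finset ι} {k : ι} (hk : k ∉ s)
    (hpos : PosDefOn H (insert k s)) : ∃ z σ, IsPivot H s k z σ := by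
  obtain ⟨y, hy0, hy⟩ := (hpos.mono (Finset.subset_insert k s)).exists_mulVec_eq fun p => H p k
  have hz0 : ∀ p ∉ insert k s, (Pi.single k 1 - y : ι → ℍ[ℝ]) p = 0 := by
    intro p hp
    simp only [Finset.mem_insert, not_or] at hp
    simp [hp.1, hy0 p hp.2]
  have hz1 : (Pi.single k 1 - y : ι → ℍ[ℝ]) k = 1 := by simp [hy0 k hk]
  have hzs : ∀ p ∈ s, (H *ᵥ (Pi.single k 1 - y)) p = 0 := by
    intro p hp
    rw [Matrix.mulVec_sub, Pi.sub_apply, hy p hp]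
    simp
  have hform : star (Pi.single k 1 - y) ⬝ᵥ (H *ᵥ (Pi.single k 1 - y)) =
      (H *ᵥ (Pi.single k 1 - y)) k := by
    rw [dotProduct, Finset.sum_eq_single k]
    · rw [Pi.star_apply, hz1]
      simp
    · intro p _ hpk
      by_cases hp : p ∈ s
      · rw [hzs p hp, mul_zero]
      · rw [Pi.star_apply, hz0 p (by simp [hp, hpk])]
        simp
    · simp
  exact ⟨_, _, hz0, hz1, hzs, hform.symm.trans (form_eq_re hH _)⟩

theorem CramerOn.colRdet_insert_mulVec {H : Matrix ι ι ℍ[ℝ]} {s : Finset ι} {k : ι} (hk : k ∉ s)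
    {d : ℝ} (hd : CramerOn H s d) {z : ι → ℍ[ℝ]} {σ : ℝ} (hz : IsPivot H s k z σ)
    (x : ι → ℍ[ℝ]) (hx : ∀ p ∉ insert k s, x p = 0) :
    colRdet H (insert k s) k (H *ᵥ x) = (d * σ : ℝ) * x k := by
  obtain ⟨-, hd1, hd2⟩ := hd
  let u : ι → ℍ[ℝ] := x - fun p => z p * x k
  have huk : u k = 0 := by simp [u, hz.one]
  have hu : ∀ p ∉ s, u p = 0 := by
    intro p hp
    by_cases hpk : p = k
    · rw [hpk, huk]
    · simp [u, hx p (by simp [hp, hpk]), hz.supp p (by simp [hp, hpk])]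
  have hHu : ∀ p, (H *ᵥ u) p = (H *ᵥ x) p - (H *ᵥ z) p * x k := by
    intro p
    rw [Matrix.mulVec_sub, Pi.sub_apply]
    simp [Matrix.mulVec, dotProduct, Finset.sum_mul, mul_assoc]
  have hcol : ∀ l ∈ s, colRdet H s l (H *ᵥ x) = d * u l := by
    intro l hl
    rw [← hd2 u hu l hl]
    refine colRdet_congr (fun _ _ _ _ => rfl) fun p hp => ?_
    rw [hHu, hz.zero p hp, zero_mul, sub_zero]
  have hsum : ∑ l ∈ s, H k l * colRdet H s l (H *ᵥ x) = d * (H *ᵥ u) k := by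
    rw [Matrix.mulVec, dotProduct_eq_of_supp hk (fun p hp => hu p fun h => hp (by simp [h])), huk,
      mul_zero, zero_add, Finset.mul_sum]
    refine Finset.sum_congr rfl fun l hl => ?_
    rw [hcol l hl, ← mul_assoc, ← mul_assoc, Quaternion.coe_commutes]
  rw [colRdet_insert hk, hsum, hd1, hHu, hz.pivot, mul_sub, Quaternion.coe_commutes, sub_sub_cancel,
    Quaternion.coe_mul, mul_assoc]

theorem CramerOn.borderRdet_eq {H : Matrix ι ι ℍ[ℝ]} {s : Finset ι} {k : ι} (hk : k ∉ s)
    {d : ℝ} (hd : CramerOn H s d) {z : ι → ℍ[ℝ]} {σ : ℝ} (hz : IsPivot H s k z σ)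
    (b : ι → ℍ[ℝ]) :
    borderRdet H s k b (fun p => H p k) = d * (b ⬝ᵥ z) := by
  obtain ⟨-, hd1, hd2⟩ := hd
  let y : ι → ℍ[ℝ] := Pi.single k 1 - z
  have hy : ∀ p ∉ s, y p = 0 := by
    intro p hp
    by_cases hpk : p = k
    · simp [y, hpk, hz.one]
    · simp [y, hpk, hz.supp p (by simp [hp, hpk])]
  have hcol : ∀ l ∈ s, colRdet H s l (fun p => H p k) = -(d * z l) := by
    intro l hl
    have hlk : l ≠ k := by rintro rfl; exact hk hl
    have : -(d * z l) = d * y l := by simp [y, hlk]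
    rw [this, ← hd2 y hy l hl]
    refine colRdet_congr (fun _ _ _ _ => rfl) fun p hp => ?_
    rw [Matrix.mulVec_sub, Pi.sub_apply, hz.zero p hp]
    simp
  rw [borderRdet, hd1, dotProduct_eq_of_supp hk hz.supp, hz.one, mul_one, mul_add,
    Finset.mul_sum, sub_eq_add_neg, ← Finset.sum_neg_distrib, Quaternion.coe_commutes]
  congr 1
  refine Finset.sum_congr rfl fun l hl => ?_
  rw [hcol l hl, mul_neg, neg_neg, ← mul_assoc, ← mul_assoc, Quaternion.coe_commutes]

theorem mulVec_pivot_symm {H : Matrix ι ι ℍ[ℝ]} (hH : Hᴴ = H) {s : Finset ι} {j k : ι}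
    {uj uk : ι → ℍ[ℝ]} {c a : ℝ} (huj : IsPivot H s j uj c) (huk : IsPivot H s k uk a) :
    (H *ᵥ uj) k = star ((H *ᵥ uk) j) := by
  have hform : ∀ (u v : ι → ℍ[ℝ]) (p : ι), (∀ q ∉ insert p s, u q = 0) → u p = 1 →
      (∀ q ∈ s, (H *ᵥ v) q = 0) → star u ⬝ᵥ (H *ᵥ v) = (H *ᵥ v) p := by
    intro u v p hu hu1 hv
    rw [dotProduct, Finset.sum_eq_single p]
    · simp [hu1]
    · intro q _ hq
      by_cases hqs : q ∈ s
      · rw [hv q hqs, mul_zero]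
      · simp [hu q (by simp [hq, hqs])]
    · simp
  rw [← hform uk uj k huk.supp huk.one huj.zero, ← hform uj uk j huj.supp huj.one huk.zero,
    star_form hH]

/-- Two successive pivots give an expression that is symmetric in the two indices. -/
theorem mul_pivot_eq {H : Matrix ι ι ℍ[ℝ]} (hH : Hᴴ = H) {s : Finset ι} {j k : ι} (hj : j ∉ s)
    (hk : k ∉ s) (hjk : j ≠ k) {uj uk z : ι → ℍ[ℝ]} {c a σ ds dk : ℝ}
    (hpos : PosDefOn H (insert j (insert k s)))
    (hds : CramerOn H s ds) (hdk : CramerOn H (insert k s) dk)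
    (huj : IsPivot H s j uj c) (huk : IsPivot H s k uk a)
    (hz : IsPivot H (insert k s) j z σ) :
    dk * σ = ds * (a * c - Quaternion.normSq ((H *ᵥ uk) j)) := by
  have hjks : j ∉ insert k s := by simp [hj, hjk]
  have ha : 0 < a := huk.pos (hpos.mono (Finset.subset_insert _ _))
  have hdk' : dk = ds * a := by
    have h1 := hdk.2.2 uk huk.supp k (Finset.mem_insert_self _ _)
    rw [hds.colRdet_insert_mulVec hk huk uk huk.supp] at h1
    rw [huk.one, mul_one, mul_one] at h1
    exact (Quaternion.coe_injective h1).symm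
  have hb := mulVec_pivot_symm hH huj huk
  let w : ι → ℍ[ℝ] := uj - fun p => uk p * ((a⁻¹ : ℝ) * (H *ᵥ uj) k)
  have hw : ∀ p, (H *ᵥ w) p = (H *ᵥ uj) p - (H *ᵥ uk) p * ((a⁻¹ : ℝ) * (H *ᵥ uj) k) := by
    intro p
    rw [Matrix.mulVec_sub, Pi.sub_apply]
    simp [Matrix.mulVec, dotProduct, Finset.sum_mul, mul_assoc]
  have hukj : uk j = 0 := huk.supp j (by simp [hj, hjk])
  have hwp : IsPivot H (insert k s) j w (c - a⁻¹ * Quaternion.normSq ((H *ᵥ uk) j)) := by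
    refine ⟨fun p hp => ?_, ?_, fun p hp => ?_, ?_⟩
    · simp only [Finset.mem_insert, not_or] at hp
      simp [w, huj.supp p (by simp [hp.1, hp.2.2]), huk.supp p (by simp [hp.2.1, hp.2.2])]
    · simp [w, huj.one, hukj]
    · rw [hw]
      rcases Finset.mem_insert.1 hp with rfl | hp
      · rw [huk.pivot, ← mul_assoc, ← Quaternion.coe_mul, mul_inv_cancel₀ ha.ne']
        simp
      · rw [huj.zero p hp, huk.zero p hp]
        simp
    · rw [hw, huj.pivot, hb, Quaternion.coe_commutes, ← mul_assoc, Quaternion.self_mul_star]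
      push_cast
      rw [Quaternion.coe_commutes]
  have h1 := hdk.colRdet_insert_mulVec hjks hz w hwp.supp
  rw [hdk.colRdet_insert_mulVec hjks hwp w hwp.supp, hwp.one, mul_one, mul_one] at h1
  rw [← Quaternion.coe_injective h1, hdk']
  field_simp

theorem exists_cramerOn {H : Matrix ι ι ℍ[ℝ]} (hH : Hᴴ = H) (α : Finset ι)
    (hpos : PosDefOn H α) : ∃ d, CramerOn H α d := by
  induction α using Finset.strongInduction with
  | H α ih =>
    rcases α.eq_empty_or_nonempty with rfl | hne
    · exact ⟨1, one_pos, by simp [pminor_empty], by simp⟩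
    have step : ∀ k ∈ α, ∃ e : ℝ, 0 < e ∧ ∃ z σ d, CramerOn H (α.erase k) d ∧
        IsPivot H (α.erase k) k z σ ∧ e = d * σ ∧
        ∀ x : ι → ℍ[ℝ], (∀ p ∉ α, x p = 0) → colRdet H α k (H *ᵥ x) = e * x k := by
      intro k hk
      have hins := Finset.insert_erase hk
      obtain ⟨d, hd⟩ := ih _ (Finset.erase_ssubset hk) (hpos.mono (Finset.erase_subset _ _))
      have hpos' : PosDefOn H (insert k (α.erase k)) := by rwa [hins]
      obtain ⟨z, σ, hz⟩ := exists_pivot hH (Finset.notMem_erase k α) hpos'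
      refine ⟨d * σ, mul_pos hd.1 (hz.pos hpos'), z, σ, d, hd, hz, rfl,
        fun x hx => ?_⟩
      have := hd.colRdet_insert_mulVec (Finset.notMem_erase k α) hz x
      rw [hins] at this
      exact this hx
    have hmin := Finset.min'_mem α hne
    obtain ⟨e, he, z₀, σ₀, d₀, hd₀, hz₀, he₀, hcol⟩ := step _ hmin
    have huniq : ∀ k ∈ α, ∀ x : ι → ℍ[ℝ], (∀ p ∉ α, x p = 0) →
        colRdet H α k (H *ᵥ x) = e * x k := by
      intro k hk
      by_cases hkm : k = α.min' hne
      · subst hkm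
        exact hcol
      obtain ⟨e', -, z', σ', d', hd', hz', he', hcol'⟩ := step k hk
      suffices e' = e by rwa [this] at hcol'
      generalize α.min' hne = j at *
      have hjk : j ≠ k := fun h => hkm h.symm
      obtain ⟨s, hsdef⟩ : ∃ s, s = (α.erase k).erase j := ⟨_, rfl⟩
      have hks : k ∉ s := by simp [hsdef]
      have hjs : j ∉ s := by simp [hsdef]
      have h1 : α.erase k = insert j s := by
        rw [hsdef, Finset.insert_erase (Finset.mem_erase.2 ⟨hjk, hmin⟩)]
      have h2 : α.erase j = insert k s := by
        rw [hsdef, Finset.erase_right_comm,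
          Finset.insert_erase (Finset.mem_erase.2 ⟨hkm, hk⟩)]
      have hα : α = insert j (insert k s) := by rw [← h2, Finset.insert_erase hmin]
      have hα' : α = insert k (insert j s) := by rw [← h1, Finset.insert_erase hk]
      have hss : s ⊂ α := by
        rw [hsdef]
        exact (Finset.erase_subset _ _).trans_ssubset (Finset.erase_ssubset hk)
      obtain ⟨ds, hds⟩ := ih s hss (hpos.mono hss.subset)
      rw [h1] at hd' hz'
      rw [h2] at hd₀ hz₀
      have hposj : PosDefOn H (insert j s) := hpos.mono (by rw [hα']; exact Finset.subset_insert _ _)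
      have hposk : PosDefOn H (insert k s) := hpos.mono (by rw [hα]; exact Finset.subset_insert _ _)
      obtain ⟨uj, c, huj⟩ := exists_pivot hH hjs hposj
      obtain ⟨uk, a, huk⟩ := exists_pivot hH hks hposk
      have e1 := mul_pivot_eq hH hjs hks hjk (by rwa [← hα]) hds hd₀ huj huk hz₀
      have e2 := mul_pivot_eq hH hks hjs hjk.symm (by rwa [← hα']) hds hd' huk huj hz'
      have hb : Quaternion.normSq ((H *ᵥ uj) k) = Quaternion.normSq ((H *ᵥ uk) j) := by
        rw [mulVec_pivot_symm hH huj huk, Quaternion.normSq_star]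
      rw [he', he₀, e1, e2, hb, mul_comm a c]
    refine ⟨e, he, ?_, fun x hx k hk => huniq k hk x hx⟩
    have hlt : ∀ x ∈ α.erase (α.min' hne), α.min' hne < x := fun x hx =>
      lt_of_le_of_ne (Finset.min'_le _ _ (Finset.mem_of_mem_erase hx))
        (Finset.ne_of_mem_erase hx).symm
    have hp := pminor_insert_of_lt_eq_colRdet hlt H
    rw [Finset.insert_erase hmin] at hp
    rw [hp]
    have := hcol (Pi.single (α.min' hne) 1) fun p hp =>
      Pi.single_eq_of_ne (by rintro rfl; exact hp hmin) _
    rw [Pi.single_eq_same, mul_one] at this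
    rw [← this]
    congr 1
    funext p
    simp

end PosDef

section MoorePenrose

theorem re_sum {ι : Type*} (s : Finset ι) (f : ι → ℍ[ℝ]) : (∑ i ∈ s, f i).re = ∑ i ∈ s, (f i).re :=
  map_sum (⟨⟨fun a : ℍ[ℝ] => a.re, rfl⟩, fun _ _ => rfl⟩ : ℍ[ℝ] →+ ℝ) f s

theorem re_star_dotProduct_self {ι : Type*} [Fintype ι] (x : ι → ℍ[ℝ]) :
    (star x ⬝ᵥ x).re = ∑ p, Quaternion.normSq (x p) := by
  rw [dotProduct, re_sum]
  refine Finset.sum_congr rfl fun p _ => ?_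
  rw [Pi.star_apply, Quaternion.star_mul_self, Quaternion.re_coe]

theorem eq_zero_of_sum_normSq {ι : Type*} [Fintype ι] {x : ι → ℍ[ℝ]}
    (h : ∑ p, Quaternion.normSq (x p) = 0) : x = 0 := by
  ext1 p
  rw [Finset.sum_eq_zero_iff_of_nonneg fun _ _ => Quaternion.normSq_nonneg] at h
  exact Quaternion.normSq_eq_zero.1 (h p (Finset.mem_univ p))

theorem eq_zero_of_star_dotProduct_self {ι : Type*} [Fintype ι] {x : ι → ℍ[ℝ]}
    (h : star x ⬝ᵥ x = 0) : x = 0 := by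
  apply eq_zero_of_sum_normSq
  rw [← re_star_dotProduct_self, h]
  rfl

theorem exists_mulVec_add_of_hermitian {ι : Type*} [Fintype ι] [LinearOrder ι]
    {H : Matrix ι ι ℍ[ℝ]} (hH : Hᴴ = H) (v : ι → ℍ[ℝ]) :
    ∃ u w : ι → ℍ[ℝ], H *ᵥ w = 0 ∧ v = H *ᵥ u + w := by
  have hdisj : Disjoint (mulVecReal H).range (mulVecReal H).ker := by
    rw [Submodule.disjoint_def]
    rintro _ ⟨u, rfl⟩ hw
    have hw' : H *ᵥ (H *ᵥ u) = 0 := hw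
    apply eq_zero_of_star_dotProduct_self
    change star (H *ᵥ u) ⬝ᵥ (H *ᵥ u) = 0
    rw [← star_form hH, hw', dotProduct_zero, star_zero]
  have hcompl : IsCompl (mulVecReal H).range (mulVecReal H).ker :=
    (Submodule.isCompl_iff_disjoint _ _
      (LinearMap.finrank_range_add_finrank_ker (mulVecReal H)).ge).2 hdisj
  have hv : v ∈ (mulVecReal H).range ⊔ (mulVecReal H).ker := by
    rw [hcompl.sup_eq_top]
    exact Submodule.mem_top
  obtain ⟨_, ⟨u, rfl⟩, w, hw, rfl⟩ := Submodule.mem_sup.1 hv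
  exact ⟨u, w, hw, rfl⟩

variable {m n s : ℕ}

theorem gram_hermitian (A : Matrix (Fin m) (Fin n) ℍ[ℝ]) :
    (A * Aᴴ)ᴴ = A * Aᴴ := by
  rw [Matrix.conjTranspose_mul, Matrix.conjTranspose_conjTranspose]

theorem star_dotProduct_gram (A : Matrix (Fin m) (Fin n) ℍ[ℝ]) (x : Fin m → ℍ[ℝ]) :
    star x ⬝ᵥ ((A * Aᴴ) *ᵥ x) = star (Aᴴ *ᵥ x) ⬝ᵥ (Aᴴ *ᵥ x) := by
  rw [← Matrix.mulVec_mulVec, Matrix.star_mulVec, Matrix.conjTranspose_conjTranspose,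
    Matrix.dotProduct_mulVec]

theorem conjTranspose_mulVec_eq_zero {A : Matrix (Fin m) (Fin n) ℍ[ℝ]} {x : Fin m → ℍ[ℝ]}
    (h : (A * Aᴴ) *ᵥ x = 0) : Aᴴ *ᵥ x = 0 := by
  apply eq_zero_of_star_dotProduct_self
  rw [← star_dotProduct_gram, h, dotProduct_zero]

theorem exists_gram_mul_eq (A : Matrix (Fin m) (Fin n) ℍ[ℝ]) :
    ∃ U : Matrix (Fin m) (Fin n) ℍ[ℝ], A * Aᴴ * U = A := by
  have hH := gram_hermitian A
  have h : ∀ j, ∃ u : Fin m → ℍ[ℝ], (A * Aᴴ) *ᵥ u = A.col j := by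
    intro j
    obtain ⟨u, w, hw, hv⟩ := exists_mulVec_add_of_hermitian hH (A.col j)
    have hAw := conjTranspose_mulVec_eq_zero hw
    have hw0 : w = 0 := by
      apply eq_zero_of_star_dotProduct_self
      have h1 : star (A.col j) ⬝ᵥ w = 0 := congrFun hAw j
      have h2 : star w ⬝ᵥ A.col j = 0 := by
        rw [Matrix.star_dotProduct, h1, star_zero]
      have h3 : star w ⬝ᵥ ((A * Aᴴ) *ᵥ u) = 0 := by
        rw [← star_form hH, hw, dotProduct_zero, star_zero]
      rwa [hv, dotProduct_add, h3, zero_add] at h2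
    exact ⟨u, by rw [hv, hw0, add_zero]⟩
  choose U hU using h
  refine ⟨Matrix.of fun i j => U j i, ?_⟩
  ext1 i j
  exact congrFun (hU j) i

theorem exists_moorePenrose (A : Matrix (Fin m) (Fin n) ℍ[ℝ]) :
    ∃ P : Matrix (Fin n) (Fin m) ℍ[ℝ], IsMoorePenrose A P := by
  obtain ⟨V, hV⟩ := exists_gram_mul_eq A
  obtain ⟨U, hU⟩ := exists_gram_mul_eq Aᴴ
  rw [Matrix.conjTranspose_conjTranspose] at hU
  have hU' : Uᴴ * (Aᴴ * A) = A := by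
    simpa [Matrix.conjTranspose_mul] using congrArg Matrix.conjTranspose hU
  have hV' : Vᴴ * (A * Aᴴ) = Aᴴ := by
    simpa [Matrix.conjTranspose_mul] using congrArg Matrix.conjTranspose hV
  have hAU : (A * U)ᴴ = A * U := by
    conv_rhs => rw [← hU', Matrix.mul_assoc, hU]
    rw [Matrix.conjTranspose_mul]
  have hVA : (Vᴴ * A)ᴴ = Vᴴ * A := by
    have h1 : Vᴴ * A = Vᴴ * A * (Vᴴ * A)ᴴ := by
      conv_lhs => rw [← hV]
      simp only [Matrix.conjTranspose_mul, Matrix.conjTranspose_conjTranspose, ← Matrix.mul_assoc]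
    rw [h1, Matrix.conjTranspose_mul, Matrix.conjTranspose_conjTranspose]
  have hAUA : A * U * A = A := by
    rw [← hAU, Matrix.conjTranspose_mul, Matrix.mul_assoc, hU']
  have hAVA : A * (Vᴴ * A) = A := by
    rw [← hVA, Matrix.conjTranspose_mul, Matrix.conjTranspose_conjTranspose, ← Matrix.mul_assoc, hV]
  have e1 : A * (Vᴴ * A * U) = A * U := by rw [← Matrix.mul_assoc, hAVA]
  have e2 : Vᴴ * A * U * A = Vᴴ * A := by
    rw [Matrix.mul_assoc Vᴴ, Matrix.mul_assoc Vᴴ, hAUA]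
  refine ⟨Vᴴ * A * U, by rw [e1, hAU], by rw [e2, hVA], by rw [e1, hAUA], ?_⟩
  rw [e2, ← Matrix.mul_assoc, Matrix.mul_assoc Vᴴ A, hAVA]

theorem IsMoorePenrose.conjTranspose_mul {A : Matrix (Fin m) (Fin n) ℍ[ℝ]}
    {P : Matrix (Fin n) (Fin m) ℍ[ℝ]} (h : IsMoorePenrose A P) : P * (A * Aᴴ) = Aᴴ := by
  rw [← Matrix.mul_assoc, ← h.right_hermitian, ← Matrix.conjTranspose_mul, ← Matrix.mul_assoc,
    h.mul_mul_self]

theorem IsMoorePenrose.mul_mul_conjTranspose {A : Matrix (Fin m) (Fin n) ℍ[ℝ]}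
    {P : Matrix (Fin n) (Fin m) ℍ[ℝ]} (h : IsMoorePenrose A P) : P * (Pᴴ * Aᴴ) = P := by
  rw [← Matrix.conjTranspose_mul, h.left_hermitian, ← Matrix.mul_assoc, h.self_mul_mul]

theorem IsMoorePenrose.unique {A : Matrix (Fin m) (Fin n) ℍ[ℝ]}
    {P Q : Matrix (Fin n) (Fin m) ℍ[ℝ]} (hP : IsMoorePenrose A P) (hQ : IsMoorePenrose A Q) :
    P = Q := by
  have h1 : A * P = A * Q := by
    rw [← hP.left_hermitian, ← hQ.left_hermitian]
    conv_lhs => rw [← hQ.mul_mul_self, Matrix.mul_assoc, Matrix.conjTranspose_mul,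
      hP.left_hermitian, hQ.left_hermitian, ← Matrix.mul_assoc, hP.mul_mul_self]
    rw [hQ.left_hermitian]
  have h2 : P * A = Q * A := by
    have h3 : P * A = P * A * (Q * A) := by
      rw [Matrix.mul_assoc P, ← Matrix.mul_assoc A, hQ.mul_mul_self]
    rw [← hP.right_hermitian, h3, Matrix.conjTranspose_mul, hP.right_hermitian,
      hQ.right_hermitian, Matrix.mul_assoc, ← Matrix.mul_assoc A, hP.mul_mul_self]
  rw [← hP.self_mul_mul, h2, Matrix.mul_assoc, h1, ← Matrix.mul_assoc, hQ.self_mul_mul]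

end MoorePenrose

section LeastSquares

attribute [local instance] Matrix.frobeniusNormedAddCommGroup

variable {m n s : ℕ}

theorem frobenius_sq (M : Matrix (Fin m) (Fin n) ℍ[ℝ]) :
    ‖M‖ ^ 2 = ∑ i, ∑ j, Quaternion.normSq (M i j) := by
  rw [Matrix.frobenius_norm_def, ← Real.sqrt_eq_rpow, Real.sq_sqrt]
  · simp only [Quaternion.normSq_eq_norm_mul_self, Real.rpow_two, sq]
  · positivity

theorem frobenius_sq_eq_re_trace (M : Matrix (Fin m) (Fin n) ℍ[ℝ]) :
    ‖M‖ ^ 2 = (M * Mᴴ).trace.re := by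
  rw [frobenius_sq, Matrix.trace, re_sum]
  refine Finset.sum_congr rfl fun i _ => ?_
  rw [Matrix.diag_apply, Matrix.mul_apply, re_sum]
  refine Finset.sum_congr rfl fun j _ => ?_
  rw [Matrix.conjTranspose_apply, Quaternion.self_mul_star, Quaternion.re_coe]

theorem frobenius_sq_add {M N : Matrix (Fin m) (Fin n) ℍ[ℝ]} (h : M * Nᴴ = 0) :
    ‖M + N‖ ^ 2 = ‖M‖ ^ 2 + ‖N‖ ^ 2 := by
  have h' : N * Mᴴ = 0 := by simpa using congrArg Matrix.conjTranspose h
  rw [frobenius_sq_eq_re_trace, frobenius_sq_eq_re_trace, frobenius_sq_eq_re_trace,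
    Matrix.conjTranspose_add, Matrix.add_mul, Matrix.mul_add, Matrix.mul_add, h, h', add_zero,
    zero_add, Matrix.trace_add]
  rfl

variable {A : Matrix (Fin m) (Fin n) ℍ[ℝ]} {P : Matrix (Fin n) (Fin m) ℍ[ℝ]}

theorem IsMoorePenrose.residual_sq (h : IsMoorePenrose A P) (B : Matrix (Fin s) (Fin n) ℍ[ℝ])
    (X : Matrix (Fin s) (Fin m) ℍ[ℝ]) :
    ‖X * A - B‖ ^ 2 = ‖(X - B * P) * A‖ ^ 2 + ‖B * P * A - B‖ ^ 2 := by
  rw [← frobenius_sq_add]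
  · congr 2
    rw [Matrix.sub_mul]
    abel
  · rw [Matrix.conjTranspose_sub, Matrix.mul_assoc B, Matrix.conjTranspose_mul,
      h.right_hermitian, Matrix.mul_sub, Matrix.mul_assoc, ← Matrix.mul_assoc A (P * A),
      ← Matrix.mul_assoc A P, h.mul_mul_self, Matrix.mul_assoc, sub_self]

theorem IsMoorePenrose.isLeastSquares_iff (h : IsMoorePenrose A P)
    {B : Matrix (Fin s) (Fin n) ℍ[ℝ]} {X : Matrix (Fin s) (Fin m) ℍ[ℝ]} :
    IsLeastSquares A B X ↔ (X - B * P) * A = 0 := by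
  constructor
  · intro hX
    have h1 := pow_le_pow_left₀ (norm_nonneg _) (hX (B * P)) 2
    rw [h.residual_sq] at h1
    have h2 : ‖(X - B * P) * A‖ ^ 2 = 0 := le_antisymm (by linarith) (sq_nonneg _)
    exact norm_eq_zero.1 (pow_eq_zero_iff two_ne_zero |>.1 h2)
  · intro h0 Y
    refine le_of_sq_le_sq ?_ (norm_nonneg _)
    rw [h.residual_sq, h.residual_sq B Y, h0, norm_zero]
    nlinarith [sq_nonneg ‖(Y - B * P) * A‖]

theorem IsMoorePenrose.norm_sq (h : IsMoorePenrose A P)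
    {B : Matrix (Fin s) (Fin n) ℍ[ℝ]} {X : Matrix (Fin s) (Fin m) ℍ[ℝ]}
    (hX : (X - B * P) * A = 0) : ‖X‖ ^ 2 = ‖B * P‖ ^ 2 + ‖X - B * P‖ ^ 2 := by
  rw [← frobenius_sq_add, add_sub_cancel]
  rw [← h.mul_mul_conjTranspose, Matrix.mul_assoc, Matrix.mul_assoc, Matrix.mul_assoc,
    h.mul_mul_conjTranspose, ← Matrix.conjTranspose_mul, hX, Matrix.conjTranspose_zero,
    Matrix.mul_zero, Matrix.mul_zero, Matrix.mul_zero]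

theorem IsMoorePenrose.isMinNormLeastSquares_iff (h : IsMoorePenrose A P)
    {B : Matrix (Fin s) (Fin n) ℍ[ℝ]} {X : Matrix (Fin s) (Fin m) ℍ[ℝ]} :
    IsMinNormLeastSquares A B X ↔ X = B * P := by
  have h0 : (B * P - B * P) * A = 0 := by rw [sub_self, Matrix.zero_mul]
  constructor
  · rintro ⟨h1, h2⟩
    have h3 := h.norm_sq (h.isLeastSquares_iff.1 h1)
    have h4 := pow_le_pow_left₀ (norm_nonneg _) (h2 _ (h.isLeastSquares_iff.2 h0)) 2
    have h5 : ‖X - B * P‖ ^ 2 = 0 := le_antisymm (by linarith) (sq_nonneg _)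
    exact sub_eq_zero.1 (norm_eq_zero.1 (pow_eq_zero_iff two_ne_zero |>.1 h5))
  · rintro rfl
    refine ⟨h.isLeastSquares_iff.2 h0, fun Y hY => le_of_sq_le_sq ?_ (norm_nonneg _)⟩
    rw [h.norm_sq (h.isLeastSquares_iff.1 hY)]
    exact le_add_of_nonneg_right (sq_nonneg _)

end LeastSquares

section Limit

open Filter Topology

theorem tendsto_sum_pow_smul {E : Type*} [NormedAddCommGroup E] [NormedSpace ℝ E] (m : ℕ)
    (c : ℕ → E) :
    Tendsto (fun t : ℝ => ∑ i ∈ Finset.range (m + 1), t ^ i • c i) (𝓝[>] 0) (𝓝 (c 0)) := by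
  have hc : Continuous fun t : ℝ => ∑ i ∈ Finset.range (m + 1), t ^ i • c i := by fun_prop
  have h0 := hc.tendsto 0
  rw [Finset.sum_range_succ'] at h0
  simp only [ne_eq, Nat.add_eq_zero_iff, one_ne_zero, and_false, not_false_eq_true, zero_pow,
    zero_smul, Finset.sum_const_zero, pow_zero, one_smul, zero_add] at h0
  exact h0.mono_left nhdsWithin_le_nhds

theorem coeff_eq_of_tendsto {E : Type*} [NormedAddCommGroup E] [NormedSpace ℝ E] {N m : ℕ}
    (hN : N ≤ m) {c : ℕ → E} {h : ℝ → E} {L : E} (hL : Tendsto h (𝓝[>] 0) (𝓝 L))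
    (heq : ∀ t : ℝ, 0 < t → ∑ i ∈ Finset.range (m + 1), t ^ i • c i = t ^ N • h t) :
    c N = L := by
  have heq' : (fun t : ℝ => ∑ i ∈ Finset.range (m + 1), t ^ i • c i) =ᶠ[𝓝[>] 0]
      fun t => t ^ N • h t :=
    eventually_nhdsWithin_of_forall fun t ht => heq t ht
  induction N generalizing m c with
  | zero =>
    refine tendsto_nhds_unique ((tendsto_sum_pow_smul m c).congr' heq') ?_
    simpa using hL
  | succ N ih =>
    obtain ⟨m, rfl⟩ : ∃ m', m = m' + 1 := ⟨m - 1, by omega⟩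
    have hpow : Tendsto (fun t : ℝ => t ^ (N + 1)) (𝓝[>] 0) (𝓝 0) := by
      have h0 := (continuous_pow (M := ℝ) (N + 1)).tendsto 0
      rw [zero_pow (Nat.succ_ne_zero N)] at h0
      exact h0.mono_left nhdsWithin_le_nhds
    have hc0 : c 0 = 0 := by
      refine tendsto_nhds_unique ((tendsto_sum_pow_smul _ c).congr' heq') ?_
      simpa using hpow.smul hL
    have hstep : ∀ t : ℝ, 0 < t →
        ∑ i ∈ Finset.range (m + 1), t ^ i • c (i + 1) = t ^ N • h t := by
      intro t ht
      have h1 := heq t ht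
      rw [Finset.sum_range_succ', hc0, smul_zero, add_zero] at h1
      simp only [pow_succ' t, mul_smul] at h1
      rw [← Finset.smul_sum] at h1
      exact smul_right_injective E ht.ne' h1
    exact ih (c := fun i => c (i + 1)) (by omega) hstep
      (eventually_nhdsWithin_of_forall fun t ht => hstep t ht)

end Limit

section Gram

variable {ι : Type*} [Fintype ι] [LinearOrder ι]

theorem CramerOn.rdet_updateRow_vecMul {H : Matrix ι ι ℍ[ℝ]} (hH : Hᴴ = H) {d : ℝ}
    (hpos : PosDefOn H Finset.univ) (hd : CramerOn H Finset.univ d) (j : ι) (x : ι → ℍ[ℝ]) :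
    rdet j (H.updateRow j (x ᵥ* H)) = d * x j := by
  have hj := Finset.notMem_erase j Finset.univ
  have hins := Finset.insert_erase (Finset.mem_univ j)
  have hpos' : PosDefOn H (insert j (Finset.univ.erase j)) := by rwa [hins]
  obtain ⟨z, σ, hz⟩ := exists_pivot hH hj hpos'
  obtain ⟨e, he⟩ := exists_cramerOn hH _ (hpos'.mono (Finset.subset_insert j _))
  have h1 := he.colRdet_insert_mulVec hj hz z hz.supp
  rw [hins, hd.2.2 z (fun p hp => absurd (Finset.mem_univ p) hp) j (Finset.mem_univ j), hz.one,
    mul_one, mul_one] at h1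
  rw [rdet_updateRow, he.borderRdet_eq hj hz, h1, ← Matrix.dotProduct_mulVec, dotProduct,
    Finset.sum_eq_single j, hz.pivot, ← Quaternion.coe_commutes, Quaternion.coe_mul, mul_assoc]
  · intro p _ hp
    rw [hz.zero p (by simp [hp]), mul_zero]
  · simp

variable {m n s : ℕ}

theorem re_form_gram (A : Matrix (Fin m) (Fin n) ℍ[ℝ]) (x : Fin m → ℍ[ℝ]) :
    (star x ⬝ᵥ ((A * Aᴴ) *ᵥ x)).re = ∑ i, Quaternion.normSq ((Aᴴ *ᵥ x) i) := by
  rw [star_dotProduct_gram, re_star_dotProduct_self]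

theorem re_form_gram_nonneg (A : Matrix (Fin m) (Fin n) ℍ[ℝ]) (x : Fin m → ℍ[ℝ]) :
    0 ≤ (star x ⬝ᵥ ((A * Aᴴ) *ᵥ x)).re := by
  rw [re_form_gram]
  exact Finset.sum_nonneg fun _ _ => Quaternion.normSq_nonneg

theorem shift_mulVec (H : Matrix ι ι ℍ[ℝ]) (t : ℝ) (x : ι → ℍ[ℝ]) :
    (H + t • (1 : Matrix ι ι ℍ[ℝ])) *ᵥ x = H *ᵥ x + t • x := by
  rw [Matrix.add_mulVec, Matrix.smul_mulVec, Matrix.one_mulVec]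

theorem re_form_shift (H : Matrix ι ι ℍ[ℝ]) (t : ℝ) (x : ι → ℍ[ℝ]) :
    (star x ⬝ᵥ ((H + t • (1 : Matrix ι ι ℍ[ℝ])) *ᵥ x)).re =
      (star x ⬝ᵥ (H *ᵥ x)).re + t * ∑ p, Quaternion.normSq (x p) := by
  rw [shift_mulVec, dotProduct_add, dotProduct_smul, ← re_star_dotProduct_self]
  rfl

theorem shift_hermitian {H : Matrix ι ι ℍ[ℝ]} (hH : Hᴴ = H) (t : ℝ) :
    (H + t • (1 : Matrix ι ι ℍ[ℝ]))ᴴ = H + t • (1 : Matrix ι ι ℍ[ℝ]) := by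
  rw [Matrix.conjTranspose_add, hH]
  congr 1
  ext1 i j
  by_cases h : i = j
  · subst h
    simp
  · simp [Matrix.one_apply_ne h, Matrix.one_apply_ne (Ne.symm h)]

theorem posDefOn_gram_shift (A : Matrix (Fin m) (Fin n) ℍ[ℝ]) {t : ℝ} (ht : 0 < t)
    (α : Finset (Fin m)) : PosDefOn (A * Aᴴ + t • (1 : Matrix (Fin m) (Fin m) ℍ[ℝ])) α := by
  intro x _ hx
  rw [re_form_shift]
  have h1 := re_form_gram_nonneg A x
  have h2 : 0 < ∑ p, Quaternion.normSq (x p) :=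
    lt_of_le_of_ne (Finset.sum_nonneg fun _ _ => Quaternion.normSq_nonneg)
      fun h => hx (eq_zero_of_sum_normSq h.symm)
  positivity

theorem star_vecMul_eq (A : Matrix (Fin m) (Fin n) ℍ[ℝ]) (g : Fin m → ℍ[ℝ]) :
    star (Aᴴ *ᵥ star g) = ∑ i, g i • A.row i := by
  rw [Matrix.star_mulVec, Matrix.conjTranspose_conjTranspose, star_star]
  ext1 j
  simp [Matrix.vecMul, dotProduct, Matrix.row]

theorem sum_smul_row_eq_of_supp (A : Matrix (Fin m) (Fin n) ℍ[ℝ]) {α : Finset (Fin m)}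
    {g : Fin m → ℍ[ℝ]} (hg : ∀ p ∉ α, g p = 0) :
    ∑ i, g i • A.row i = ∑ i ∈ α, g i • A.row i :=
  (Finset.sum_subset (Finset.subset_univ α) fun p _ hp => by rw [hg p hp, zero_smul]).symm

theorem posDefOn_gram {A : Matrix (Fin m) (Fin n) ℍ[ℝ]} {α : Finset (Fin m)}
    (hα : LinearIndepOn ℍ[ℝ] A.row (α : Set (Fin m))) : PosDefOn (A * Aᴴ) α := by
  intro x hx hx0
  rw [re_form_gram]
  refine lt_of_le_of_ne (Finset.sum_nonneg fun _ _ => Quaternion.normSq_nonneg) fun h => hx0 ?_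
  have h1 := eq_zero_of_sum_normSq h.symm
  have h2 := star_vecMul_eq A (star x)
  rw [star_star, h1, star_zero, sum_smul_row_eq_of_supp A (α := α)
    fun p hp => by rw [Pi.star_apply, hx p hp, star_zero]] at h2
  ext1 p
  by_cases hp : p ∈ α
  · exact star_eq_zero.1 (linearIndepOn_finset_iff.1 hα _ h2.symm p hp)
  · exact hx p hp

open Filter Topology in
theorem tendsto_sum_powerset_smul {E : Type*} [NormedAddCommGroup E] [NormedSpace ℝ E]
    (α : Finset ι) (g : Finset ι → E) :
    Tendsto (fun t : ℝ => ∑ β ∈ α.powerset, t ^ (α \ β).card • g β) (𝓝[>] 0) (𝓝 (g α)) := by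
  have hc : Continuous fun t : ℝ => ∑ β ∈ α.powerset, t ^ (α \ β).card • g β := by fun_prop
  have h0 := hc.tendsto 0
  rw [Finset.sum_eq_single α] at h0
  · simp only [Finset.sdiff_self, Finset.card_empty, pow_zero, one_smul] at h0
    exact h0.mono_left nhdsWithin_le_nhds
  · intro β hβ hne
    have : (α \ β).card ≠ 0 := by
      rw [Ne, Finset.card_eq_zero, Finset.sdiff_eq_empty_iff_subset]
      exact fun h => hne (Finset.Subset.antisymm (Finset.mem_powerset.1 hβ) h)
    rw [zero_pow this, zero_smul]
  · simp

open Filter Topology in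
theorem pminor_gram_eq_zero {A : Matrix (Fin m) (Fin n) ℍ[ℝ]} {α : Finset (Fin m)}
    (hα : ¬ LinearIndepOn ℍ[ℝ] A.row (α : Set (Fin m))) : pminor (A * Aᴴ) α = 0 := by
  rw [linearIndepOn_finset_iff] at hα
  push Not at hα
  obtain ⟨g, hg, k, hk, hgk⟩ := hα
  let x : Fin m → ℍ[ℝ] := fun p => if p ∈ α then star (g p) else 0
  have hx : ∀ p ∉ α, x p = 0 := fun p hp => if_neg hp
  have hxk : x k ≠ 0 := by
    simp only [x, if_pos hk]
    exact star_ne_zero.2 hgk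
  have hAx : Aᴴ *ᵥ x = 0 := by
    have h2 := star_vecMul_eq A (star x)
    rw [sum_smul_row_eq_of_supp A (α := α)
      fun p hp => by rw [Pi.star_apply, hx p hp, star_zero]] at h2
    have h3 : ∑ i ∈ α, (star x) i • A.row i = 0 := by
      rw [← hg]
      refine Finset.sum_congr rfl fun p hp => ?_
      simp [x, hp]
    rw [h3, star_star] at h2
    exact star_eq_zero.1 h2
  have hHx : (A * Aᴴ) *ᵥ x = 0 := by rw [← Matrix.mulVec_mulVec, hAx, Matrix.mulVec_zero]
  have hH := gram_hermitian A
  have key : ∀ t : ℝ, 0 < t →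
      t • ∑ β ∈ α.powerset, t ^ (α \ β).card • colRdet (A * Aᴴ) β k x =
        (∑ β ∈ α.powerset, t ^ (α \ β).card • pminor (A * Aᴴ) β) * x k := by
    intro t ht
    obtain ⟨d, hd⟩ := exists_cramerOn (shift_hermitian hH t) α (posDefOn_gram_shift A ht α)
    rw [← pminor_shift, hd.2.1, ← hd.2.2 x hx k hk, ← colRdet_shift, shift_mulVec, hHx, zero_add]
    have : t • x = fun p => x p * (t : ℍ[ℝ]) := by
      ext1 p
      rw [Pi.smul_apply, ← Quaternion.coe_commutes, Quaternion.coe_mul_eq_smul]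
    rw [this, colRdet_mul _ _ _ _ _ fun β _ => Quaternion.coe_commutes _ _,
      ← Quaternion.coe_commutes, Quaternion.coe_mul_eq_smul]
  have h1 := (tendsto_sum_powerset_smul α fun β => pminor (A * Aᴴ) β).mul_const (x k)
  have h2 : Tendsto (fun t : ℝ => t • ∑ β ∈ α.powerset,
      t ^ (α \ β).card • colRdet (A * Aᴴ) β k x) (𝓝[>] 0) (𝓝 0) := by
    have h3 : Tendsto (fun t : ℝ => t) (𝓝[>] 0) (𝓝 0) := tendsto_id.mono_left nhdsWithin_le_nhds
    simpa using h3.smul (tendsto_sum_powerset_smul α fun β => colRdet (A * Aᴴ) β k x)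
  have h3 := tendsto_nhds_unique_of_eventuallyEq h2 h1 (eventually_nhdsWithin_of_forall key)
  exact (mul_eq_zero.1 h3.symm).resolve_right hxk

theorem pminor_gram_nonneg (A : Matrix (Fin m) (Fin n) ℍ[ℝ]) (α : Finset (Fin m)) :
    ∃ d : ℝ, 0 ≤ d ∧ pminor (A * Aᴴ) α = d ∧
      (LinearIndepOn ℍ[ℝ] A.row (α : Set (Fin m)) → 0 < d) := by
  by_cases hα : LinearIndepOn ℍ[ℝ] A.row (α : Set (Fin m))
  · obtain ⟨d, hd⟩ := exists_cramerOn (gram_hermitian A) α (posDefOn_gram hα)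
    exact ⟨d, hd.1.le, hd.2.1, fun _ => hd.1⟩
  · exact ⟨0, le_rfl, by rw [pminor_gram_eq_zero hα, Quaternion.coe_zero], fun h => absurd h hα⟩

theorem rank_le (A : Matrix (Fin m) (Fin n) ℍ[ℝ]) : rank A ≤ m := by
  have := finrank_range_le_card (R := ℍ[ℝ]) A.row
  rwa [Fintype.card_fin] at this

theorem sumPrincipalMinors_gram_eq_zero (A : Matrix (Fin m) (Fin n) ℍ[ℝ]) {r : ℕ}
    (hr : rank A < r) : sumPrincipalMinors r (A * Aᴴ) = 0 := by
  refine Finset.sum_eq_zero fun α hα => pminor_gram_eq_zero fun hli => ?_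
  rw [Finset.mem_powersetCard_univ] at hα
  have h1 : LinearIndependent ℍ[ℝ] fun p : {p // p ∈ α} => A.row p := hli
  have h2 := finrank_span_eq_card h1
  rw [Fintype.card_coe, hα] at h2
  have h3 : Submodule.span ℍ[ℝ] (Set.range fun p : {p // p ∈ α} => A.row p) ≤
      Submodule.span ℍ[ℝ] (Set.range A.row) :=
    Submodule.span_mono (by rintro _ ⟨p, rfl⟩; exact ⟨p, rfl⟩)
  have h4 := Submodule.finrank_mono h3
  rw [h2] at h4
  exact absurd hr (not_lt.2 h4)

theorem exists_linearIndepOn_rank (A : Matrix (Fin m) (Fin n) ℍ[ℝ]) :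
    ∃ α : Finset (Fin m), α.card = rank A ∧ LinearIndepOn ℍ[ℝ] A.row (α : Set (Fin m)) := by
  classical
  obtain ⟨κ, a, ha, hspan, hli⟩ := exists_linearIndependent' ℍ[ℝ] A.row
  have : Finite κ := Finite.of_injective a ha
  cases nonempty_fintype κ
  refine ⟨Finset.univ.image a, ?_, ?_⟩
  · rw [Finset.card_image_of_injective _ ha, Finset.card_univ, rank, ← hspan,
      finrank_span_eq_card hli]
  · rw [Finset.coe_image, Finset.coe_univ, Set.image_univ]
    exact (linearIndepOn_range_iff ha A.row).2 hli

theorem sumPrincipalMinors_gram_pos (A : Matrix (Fin m) (Fin n) ℍ[ℝ]) :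
    ∃ d : ℝ, 0 < d ∧ sumPrincipalMinors (rank A) (A * Aᴴ) = d := by
  choose d hd0 hd hdpos using pminor_gram_nonneg A
  obtain ⟨α, hα, hli⟩ := exists_linearIndepOn_rank A
  refine ⟨∑ β ∈ Finset.univ.powersetCard (rank A), d β, ?_, ?_⟩
  · exact Finset.sum_pos' (fun β _ => hd0 β)
      ⟨α, Finset.mem_powersetCard_univ.2 hα, hdpos α hli⟩
  · rw [← Quaternion.algebraMap_def, map_sum]
    exact Finset.sum_congr rfl fun β _ => hd β

theorem sum_normSq_smul_le (A : Matrix (Fin m) (Fin n) ℍ[ℝ]) {t : ℝ} (ht : 0 < t)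
    (u : Fin m → ℍ[ℝ]) :
    ∑ p, Quaternion.normSq ((t • u) p) ≤ ∑ p, Quaternion.normSq
      (((A * Aᴴ + t • (1 : Matrix (Fin m) (Fin m) ℍ[ℝ])) *ᵥ u) p) := by
  have hH := gram_hermitian A
  have h1 : star ((A * Aᴴ) *ᵥ u) ⬝ᵥ u = star (star u ⬝ᵥ ((A * Aᴴ) *ᵥ u)) :=
    Matrix.star_dotProduct _ _
  have h2 := re_form_gram_nonneg A u
  have h3 : 0 ≤ (star ((A * Aᴴ) *ᵥ u) ⬝ᵥ ((A * Aᴴ) *ᵥ u)).re := by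
    rw [re_star_dotProduct_self]
    exact Finset.sum_nonneg fun _ _ => Quaternion.normSq_nonneg
  have hst : star (t • u) = t • star u := by
    ext1 p
    simp
  rw [← re_star_dotProduct_self, ← re_star_dotProduct_self, shift_mulVec, star_add,
    dotProduct_add, add_dotProduct, add_dotProduct, hst]
  simp only [smul_dotProduct, dotProduct_smul, h1, Quaternion.re_add, Quaternion.re_smul, Quaternion.re_star]
  have := mul_nonneg ht.le h2
  simp only [smul_eq_mul]
  linarith

open Filter Topology in
theorem exists_regularized (A : Matrix (Fin m) (Fin n) ℍ[ℝ]) (y : Fin m → ℍ[ℝ]) :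
    ∃ x : ℝ → Fin m → ℍ[ℝ],
      (∀ t, 0 < t → x t ᵥ* (A * Aᴴ + t • (1 : Matrix (Fin m) (Fin m) ℍ[ℝ])) =
        (y ᵥ* (A * Aᴴ)) ᵥ* (A * Aᴴ)) ∧
      ∀ j, Tendsto (fun t => x t j) (𝓝[>] 0) (𝓝 ((y ᵥ* (A * Aᴴ)) j)) := by
  have hH := gram_hermitian A
  have hex : ∀ t : ℝ, ∃ u : Fin m → ℍ[ℝ], 0 < t →
      (A * Aᴴ + t • (1 : Matrix (Fin m) (Fin m) ℍ[ℝ])) *ᵥ u = star y := by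
    intro t
    by_cases ht : 0 < t
    · obtain ⟨u, -, hu⟩ := (posDefOn_gram_shift A ht Finset.univ).exists_mulVec_eq (star y)
      exact ⟨u, fun _ => funext fun p => hu p (Finset.mem_univ p)⟩
    · exact ⟨0, fun h => absurd h ht⟩
  choose u hu using hex
  have hadd : ∀ (t : ℝ) (x : Fin m → ℍ[ℝ]),
      x ᵥ* (A * Aᴴ + t • (1 : Matrix (Fin m) (Fin m) ℍ[ℝ])) = x ᵥ* (A * Aᴴ) + t • x := by
    intro t x
    rw [Matrix.vecMul_add, Matrix.vecMul_smul, Matrix.vecMul_one]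
  have huy : ∀ t, 0 < t → star (u t) ᵥ* (A * Aᴴ) + t • star (u t) = y := by
    intro t ht
    have h1 := congrArg star (hu t ht)
    rw [Matrix.star_mulVec, shift_hermitian hH, star_star] at h1
    rw [← hadd, h1]
  refine ⟨fun t => y ᵥ* (A * Aᴴ) - t • y + (t * t) • star (u t), fun t ht => ?_, fun j => ?_⟩
  · have h2 : star (u t) ᵥ* (A * Aᴴ) = y - t • star (u t) := eq_sub_of_add_eq (huy t ht)
    rw [hadd, Matrix.add_vecMul, Matrix.sub_vecMul, Matrix.smul_vecMul, Matrix.smul_vecMul, h2]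
    module
  · rw [tendsto_iff_norm_sub_tendsto_zero]
    have hbound : ∀ t : ℝ, 0 < t → ‖(y ᵥ* (A * Aᴴ) - t • y + (t * t) • star (u t)) j -
        (y ᵥ* (A * Aᴴ)) j‖ ≤ t * (‖y j‖ + √(∑ p, Quaternion.normSq ((star y) p))) := by
      intro t ht
      have h1 : ‖(t • u t) j‖ ≤ √(∑ p, Quaternion.normSq ((star y) p)) := by
        apply Real.le_sqrt_of_sq_le
        rw [sq, ← Quaternion.normSq_eq_norm_mul_self, ← hu t ht]
        exact (Finset.single_le_sum (f := fun p => Quaternion.normSq ((t • u t) p))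
          (fun _ _ => Quaternion.normSq_nonneg) (Finset.mem_univ j)).trans
          (sum_normSq_smul_le A ht (u t))
      have h2 : (y ᵥ* (A * Aᴴ) - t • y + (t * t) • star (u t)) j - (y ᵥ* (A * Aᴴ)) j =
          t • (star ((t • u t) j) - y j) := by
        simp only [Pi.add_apply, Pi.sub_apply, Pi.smul_apply, Pi.star_apply, Quaternion.star_smul]
        module
      rw [h2, norm_smul, Real.norm_of_nonneg ht.le]
      refine mul_le_mul_of_nonneg_left ((norm_sub_le _ _).trans ?_) ht.le
      rw [Quaternion.norm_star, add_comm]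
      exact add_le_add_right h1 _
    refine squeeze_zero' (Eventually.of_forall fun _ => norm_nonneg _)
      (eventually_nhdsWithin_of_forall hbound) ?_
    have h3 : Tendsto (fun t : ℝ => t * (‖y j‖ + √(∑ p, Quaternion.normSq ((star y) p))))
        (𝓝 0) (𝓝 (0 * (‖y j‖ + √(∑ p, Quaternion.normSq ((star y) p))))) :=
      tendsto_id.mul_const _
    rw [zero_mul] at h3
    exact h3.mono_left nhdsWithin_le_nhds

theorem pminor_gram_shift (A : Matrix (Fin m) (Fin n) ℍ[ℝ]) (t : ℝ) :
    pminor (A * Aᴴ + t • (1 : Matrix (Fin m) (Fin m) ℍ[ℝ])) Finset.univ = t ^ (m - rank A) •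
      ∑ i ∈ Finset.range (rank A + 1), t ^ i • sumPrincipalMinors (rank A - i) (A * Aᴴ) := by
  have hr := rank_le A
  rw [pminor_univ_shift, Fintype.card_fin,
    ← Finset.sum_range_reflect (fun i => t ^ i • sumPrincipalMinors (rank A - i) (A * Aᴴ)),
    Finset.smul_sum]
  symm
  refine Finset.sum_subset_zero_on_sdiff (Finset.range_mono (by omega)) ?_ ?_
  · intro k hk
    rw [Finset.mem_sdiff, Finset.mem_range, Finset.mem_range] at hk
    rw [sumPrincipalMinors_gram_eq_zero A (by omega), smul_zero]
  · intro k hk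
    rw [Finset.mem_range] at hk
    rw [smul_smul, ← pow_add]
    congr 2
    · omega
    · omega

/-- The numerator of the determinantal representation, for a right-hand side in the row space. -/
theorem sumPrincipalRdet_gram (A : Matrix (Fin m) (Fin n) ℍ[ℝ]) (y : Fin m → ℍ[ℝ]) (j : Fin m) :
    sumPrincipalRdet (rank A) j
        ((A * Aᴴ).updateRow j ((y ᵥ* (A * Aᴴ)) ᵥ* (A * Aᴴ))) =
      sumPrincipalMinors (rank A) (A * Aᴴ) * (y ᵥ* (A * Aᴴ)) j := by
  have hH := gram_hermitian A
  have hr := rank_le A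
  obtain ⟨x, hx, hlim⟩ := exists_regularized A y
  have hE := (tendsto_sum_pow_smul (rank A)
    fun i => sumPrincipalMinors (rank A - i) (A * Aᴴ)).mul (hlim j)
  have key := coeff_eq_of_tendsto (N := m - rank A) (m := m) (by omega)
    (c := fun i => sumPrincipalRdet (m - i) j
      ((A * Aᴴ).updateRow j ((y ᵥ* (A * Aᴴ)) ᵥ* (A * Aᴴ)))) hE ?_
  · simpa [Nat.sub_sub_self hr] using key
  · intro t ht
    obtain ⟨d, hd⟩ := exists_cramerOn (shift_hermitian hH t) Finset.univ
      (posDefOn_gram_shift A ht _)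
    have h1 := hd.rdet_updateRow_vecMul (shift_hermitian hH t) (posDefOn_gram_shift A ht _) j (x t)
    rw [← hd.2.1, pminor_gram_shift, hx t ht, rdet_updateRow_shift, Fintype.card_fin,
      smul_mul_assoc] at h1
    rw [← h1, ← Finset.sum_range_reflect]
    refine Finset.sum_congr rfl fun k hk => ?_
    rw [Finset.mem_range] at hk
    congr 2
    omega

/-- The determinantal representation of the solution when the rows are independent. -/
theorem rdet_gram (A : Matrix (Fin m) (Fin n) ℍ[ℝ]) (hA : rank A = m) :
    ∃ d : ℝ, 0 < d ∧ ddet A = d ∧ ∀ (x : Fin m → ℍ[ℝ]) (j : Fin m),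
      rdet j ((A * Aᴴ).updateRow j (x ᵥ* (A * Aᴴ))) = d * x j := by
  have hH := gram_hermitian A
  have hli : LinearIndependent ℍ[ℝ] A.row := by
    rw [linearIndependent_iff_card_eq_finrank_span, Fintype.card_fin]
    exact hA.symm
  have hpos : PosDefOn (A * Aᴴ) Finset.univ :=
    posDefOn_gram (by rwa [Finset.coe_univ, linearIndepOn_univ_iff])
  obtain ⟨d, hd⟩ := exists_cramerOn hH Finset.univ hpos
  exact ⟨d, hd.1, by rw [ddet, hdet_eq_pminor, hd.2.1],
    fun x j => hd.rdet_updateRow_vecMul hH hpos j x⟩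

end Gram

end QuatCramer

theorem theorem4p4 {m n s : ℕ} (A : Matrix (Fin m) (Fin n) ℍ[ℝ])
    (B : Matrix (Fin s) (Fin n) ℍ[ℝ]) :
    (∃! P : Matrix (Fin n) (Fin m) ℍ[ℝ], QuatCramer.IsMoorePenrose A P) ∧
    (∃! X : Matrix (Fin s) (Fin m) ℍ[ℝ], QuatCramer.IsMinNormLeastSquares A B X) ∧
    ∀ (P : Matrix (Fin n) (Fin m) ℍ[ℝ]) (X : Matrix (Fin s) (Fin m) ℍ[ℝ]),
      QuatCramer.IsMoorePenrose A P → QuatCramer.IsMinNormLeastSquares A B X →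
      X = B * P ∧
      (∀ r : ℕ, QuatCramer.rank A = r → r ≤ n → n < m →
        QuatCramer.sumPrincipalMinors r (A * Aᴴ) ≠ 0 ∧
        ∀ (i : Fin s) (j : Fin m),
          X i j =
            QuatCramer.sumPrincipalRdet r j ((A * Aᴴ).updateRow j ((B * Aᴴ).row i)) /
              QuatCramer.sumPrincipalMinors r (A * Aᴴ)) ∧
      (QuatCramer.rank A = m →
        QuatCramer.ddet A ≠ 0 ∧
        ∀ (i : Fin s) (j : Fin m),
          X i j =
            QuatCramer.rdet j ((A * Aᴴ).updateRow j ((B * Aᴴ).row i)) /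
              QuatCramer.ddet A) := by
  obtain ⟨P₀, hP₀⟩ := QuatCramer.exists_moorePenrose A
  refine ⟨⟨P₀, hP₀, fun Q hQ => hQ.unique hP₀⟩,
    ⟨B * P₀, hP₀.isMinNormLeastSquares_iff.2 rfl, fun X hX => hP₀.isMinNormLeastSquares_iff.1 hX⟩,
    fun P X hP hX => ?_⟩
  have hXP : X = B * P := hP.isMinNormLeastSquares_iff.1 hX
  have hBA : B * Aᴴ = X * (A * Aᴴ) := by rw [hXP, Matrix.mul_assoc, hP.conjTranspose_mul]
  have hrow : ∀ i, (B * Aᴴ).row i = X.row i ᵥ* (A * Aᴴ) := by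
    intro i
    rw [hBA]
    rfl
  refine ⟨hXP, fun r hr _ _ => ?_, fun hr => ?_⟩
  · subst hr
    obtain ⟨d, hd, hdet⟩ := QuatCramer.sumPrincipalMinors_gram_pos A
    have hd0 : (d : ℍ[ℝ]) ≠ 0 := fun h => hd.ne' (Quaternion.coe_injective h)
    rw [hdet]
    refine ⟨hd0, fun i j => ?_⟩
    have hXy : X = B * P * Pᴴ * P * (A * Aᴴ) := by
      rw [Matrix.mul_assoc _ P, hP.conjTranspose_mul, Matrix.mul_assoc _ Pᴴ, Matrix.mul_assoc B,
        hP.mul_mul_conjTranspose, hXP]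
    have hy : X.row i = (B * P * Pᴴ * P).row i ᵥ* (A * Aᴴ) := congrArg (fun M => M.row i) hXy
    rw [hrow, hy, QuatCramer.sumPrincipalRdet_gram, hdet, ← hy, Quaternion.coe_commutes,
      mul_div_cancel_right₀ _ hd0]
    rfl
  · obtain ⟨d, hd, hdet, hcramer⟩ := QuatCramer.rdet_gram A hr
    have hd0 : (d : ℍ[ℝ]) ≠ 0 := fun h => hd.ne' (Quaternion.coe_injective h)
    rw [hdet]
    refine ⟨hd0, fun i j => ?_⟩
    rw [hrow, hcramer, Quaternion.coe_commutes, mul_div_cancel_right₀ _ hd0]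
    rfl
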